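/- Let $\lambda>0$ and $\nu\ge 1$, and let $X\sim\mathrm{CMP}(\lambda,\nu)$, i.e. $X$ takes values in $\mathbb Z^+=\{0,1,2,\dots\}$ with $$\mathbb P(X=j)=\frac{1}{Z(\lambda,\nu)}\frac{\lambda^j}{(j!)^\nu},\qquad Z(\lambda,\nu)=\sum_{i=0}^\infty\frac{\lambda^i}{(i!)^\nu}.$$ Then $X$ has a finite second moment and $\mu=\mathbb E X>0$, and, with $\mathrm{Po}(\mu)$ denoting the Poisson distribution of mean $\mu$: (i) $$d_{TV}(\mathcal L(X),\mathrm{Po}(\mu))\le\frac1\mu\bigl(\mu-\mathrm{Var}(X)\bigr),$$ where $d_{TV}(\mathcal L(U),\mathcal L(V))=\sup_{A\subseteq\mathbb Z^+}|\mathbb P(U\in A)-\mathbb P(V\in A)|$; moreover, for fixed $\nu$, the right-hand side equals $\frac{\nu-1}{\nu}+O(\lambda^{-1/\nu})$ as $\lambda\to\infty$. (ii) $$\mathrm{Var}(X)\le R_X\le\mu,$$ where $R_X$ is the Poincaré (inverse spectral gap) constant $$R_X=\sup_{g}\frac{\mathbb E[g(X)^2]}{\mathbb E[\{g(X+1)-g(X)\}^2]},$$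 the supremum being over all $g:\mathbb Z^+\to\mathbb R$ with $\mathbb E[g(X)^2]<\infty$ and $\mathbb E\,g(X)=0$ (the ratio is computed in $[0,\infty]$ with $0/0=0$, $a/0=\infty$ for $a>0$, and $a/\infty=0$ for finite $a$). (iii) $X\le_{cx}Z$ for $Z\sim\mathrm{Po}(\mu)$, i.e. $\mathbb EX=\mathbb EZ$ and $\mathbb E f(X)\le\mathbb E f(Z)$ for every convex $f:\mathbb R\to\mathbb R$ (expectations in $(-\infty,\infty]$). Moreover, $$\mathbb P(X\ge\mu+t)\le e^{t}\Bigl(1+\frac t\mu\Bigr)^{-(\mu+t)}\quad(t\ge0),\qquad \mathbb P(X\le\mu-t)\le e^{-t}\Bigl(1-\frac t\mu\Bigr)^{t-\mu}\quad(0\le t<\mu).$$ -/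

import Mathlib

open MeasureTheory ProbabilityTheory Filter Asymptotics
open scoped Nat NNReal ENNReal

noncomputable section

/-- The normalizing constant `Z(l, ν) = ∑ i, l ^ i / (i!) ^ ν` of the Conway-Maxwell-Poisson
distribution. -/
def cmpNormalizer (l ν : ℝ) : ℝ := ∑' i : ℕ, l ^ i / ((i ! : ℕ) : ℝ) ^ ν

/-- The probability mass at `j` of the Conway-Maxwell-Poisson distribution `CMP(l, ν)`. -/
def cmpMass (l ν : ℝ) (j : ℕ) : ℝ :=
  1 / cmpNormalizer l ν * (l ^ j / ((j ! : ℕ) : ℝ) ^ ν)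

/-- The Conway-Maxwell-Poisson distribution `CMP(l, ν)`, as a measure on `ℕ`. -/
def cmpMeasure (l ν : ℝ) : Measure ℕ :=
  Measure.sum fun j : ℕ => ENNReal.ofReal (cmpMass l ν j) • Measure.dirac j

/-- Total variation distance `sup_A |P(A) - Q(A)|` between two probability measures on `ℕ`. -/
def natTVDist (P Q : Measure ℕ) : ℝ := ⨆ A : Set ℕ, |P.real A - Q.real A|

/-- The class of functions `g : ℕ → ℝ` with `E[g(U)^2] < ∞` and `E[g(U)] = 0`. -/
def poincareClass {Ω : Type*} [MeasurableSpace Ω] (U : Ω → ℕ) (P : Measure Ω) : Set (ℕ → ℝ) :=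
  {g | MemLp (fun ω => g (U ω)) 2 P ∧ ∫ ω, g (U ω) ∂P = 0}

/-- The Poincaré (inverse spectral gap) constant of an `ℕ`-valued random variable `U`: the
supremum, over `g` in `poincareClass U P`, of `E[g(U)^2] / E[(g(U+1) - g(U))^2]`. It is computed
in `[0, ∞]`, where `0 / 0 = 0`, `a / 0 = ∞` for `a > 0`, and `a / ∞ = 0` for finite `a`. -/
def poincareConstant {Ω : Type*} [MeasurableSpace Ω] (U : Ω → ℕ) (P : Measure Ω) : ℝ≥0∞ :=
  ⨆ g ∈ poincareClass U P,
    (∫⁻ ω, ENNReal.ofReal (g (U ω) ^ 2) ∂P) /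
      (∫⁻ ω, ENNReal.ofReal ((g (U ω + 1) - g (U ω)) ^ 2) ∂P)

/-- The convex order `P ≤_cx Q` on laws on the real line: both means exist and agree, and
`∫ f ∂P ≤ ∫ f ∂Q` for all convex `f : ℝ → ℝ`. As the negative part of a convex function is then
integrable, both expectations exist in `(-∞, ∞]`, and the inequality means: when the one on the
right is finite, so is the one on the left, and it is at most the one on the right. -/
def ConvexOrderLE (P Q : Measure ℝ) : Prop :=
  Integrable (fun x : ℝ => x) P ∧ Integrable (fun x : ℝ => x) Q ∧ ∫ x, x ∂P = ∫ x, x ∂Q ∧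
    ∀ f : ℝ → ℝ, ConvexOn ℝ Set.univ f → Integrable f Q →
      Integrable f P ∧ ∫ x, f x ∂P ≤ ∫ x, f x ∂Q

end

/-! Everything except the expansion in (i) rests on ultra log-concavity. With mass function p, `(j +
1) p (j + 1) = c j * p j`, where `c j = l * (j + 1) ^ (1 - ν)` decreases because `ν ≥ 1`; for the
Poisson law `c` is the constant mean m. Since `c` decreases and averages to m, the tail sums of `(m
- c i) p i` are nonnegative (`tail_nonneg`), and summed from index 1 on they give m minus the
variance (`hasSum_tail`).

Total variation: summing the Poisson Stein equation against p and summing by parts turns the error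
into increments of the Stein solution weighted by these tails; each increment is at most `1 / m`
(`steinSolution_sub_le`). Poincaré: twice the variance of g is the mean squared difference of two
independent copies. Cauchy-Schwarz along the path between them leaves, in front of the j-th squared
increment, a weight at most `m * p j`, again because the tail is nonnegative (`tsum_sq_le`). The
lower bound uses the centred identity as test function. Convex order: p over the Poisson mass is
unimodal, so, unless the laws agree, their difference has sign pattern -, +, -. A convex f minus its
chord through the crossing points has the opposite pattern, and the chord has the same mean under
both laws (`convex_order`). Applied to `z ^ x`, with Markov's inequality, this gives both
concentration bounds.

Expansion: put `α = r ^ (1 / ν)`, `U = X / α - 1`, `δ = 1 / α`. The exact identity E[((1 + U)^ν - 1)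
g(U)] = E[g(U + δ) - g(U)] for g = 1, U, U², U³, with Taylor bounds valid on all of `u ≥ -1`, yields
E U = O(δ) and ν E U² = δ + O(δ²), without Laplace asymptotics of the normalizer. -/

/-- A strictly positive probability mass function `p` on `ℕ` with mean `m`, second moment `s`, and
`(j + 1) * p (j + 1) = c j * p j` for an antitone sequence `c` (ultra log-concavity). -/
structure IsUltraLogConcave (p c : ℕ → ℝ) (m s : ℝ) : Prop where
  pos : ∀ j, 0 < p j
  antitone : Antitone c
  rec_eq : ∀ j : ℕ, ((j : ℝ) + 1) * p (j + 1) = c j * p j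
  hasSum_one : HasSum p 1
  hasSum_mean : HasSum (fun j : ℕ => (j : ℝ) * p j) m
  hasSum_sq : HasSum (fun j : ℕ => (j : ℝ) ^ 2 * p j) s

/-! ### Tail sums of an ultra log-concave law -/

namespace IsUltraLogConcave

variable {p c : ℕ → ℝ} {m s : ℝ}

/-- The tail sum `∑_{i ≥ j} (m - c i) * p i`. -/
noncomputable def tail (p c : ℕ → ℝ) (m : ℝ) (j : ℕ) : ℝ := ∑' i, (m - c (i + j)) * p (i + j)

lemma mean_pos (h : IsUltraLogConcave p c m s) : 0 < m := by
  have h1 := h.hasSum_mean.summable.sum_le_tsum {1}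
    (fun i _ => mul_nonneg (Nat.cast_nonneg i) (h.pos i).le)
  rw [h.hasSum_mean.tsum_eq] at h1
  have h2 := h.pos 1
  simp at h1
  linarith

lemma hasSum_coeff (h : IsUltraLogConcave p c m s) : HasSum (fun j => c j * p j) m := by
  have := (hasSum_nat_add_iff' 1).2 h.hasSum_mean
  simp only [Finset.range_one, Finset.sum_singleton, Nat.cast_zero, zero_mul, sub_zero] at this
  refine HasSum.congr_fun this ?_
  intro j
  rw [← h.rec_eq]
  push_cast
  rfl

lemma hasSum_diff (h : IsUltraLogConcave p c m s) : HasSum (fun j => (m - c j) * p j) 0 := by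
  have := (h.hasSum_one.mul_left m).sub h.hasSum_coeff
  simpa [sub_mul] using this

lemma hasSum_mul_coeff (h : IsUltraLogConcave p c m s) :
    HasSum (fun j : ℕ => (j : ℝ) * (c j * p j)) (s - m) := by
  have := (hasSum_nat_add_iff' 1).2 (h.hasSum_sq.sub h.hasSum_mean)
  simp only [Finset.range_one, Finset.sum_singleton, Nat.cast_zero, zero_mul, sub_zero] at this
  refine (HasSum.congr_fun · ?_) (by simpa using this)
  intro j
  rw [← h.rec_eq]
  ring

lemma hasSum_mul_diff (h : IsUltraLogConcave p c m s) :
    HasSum (fun j : ℕ => (j : ℝ) * ((m - c j) * p j)) (m - (s - m ^ 2)) := by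
  convert! (h.hasSum_mean.mul_left m).sub h.hasSum_mul_coeff using 1
  · ext j; ring
  · ring

lemma tail_zero (h : IsUltraLogConcave p c m s) : tail p c m 0 = 0 := by
  simpa [tail] using h.hasSum_diff.tsum_eq

lemma sum_add_tail (h : IsUltraLogConcave p c m s) (j : ℕ) :
    ∑ i ∈ Finset.range j, (m - c i) * p i + tail p c m j = 0 := by
  rw [tail, h.hasSum_diff.summable.sum_add_tsum_nat_add j, h.hasSum_diff.tsum_eq]

lemma tail_succ (h : IsUltraLogConcave p c m s) (j : ℕ) :
    tail p c m j = (m - c j) * p j + tail p c m (j + 1) := by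
  have h1 := h.sum_add_tail j
  have h2 := h.sum_add_tail (j + 1)
  rw [Finset.sum_range_succ] at h2
  linarith

/-- As `c` decreases, `m - c i` changes sign at most once, from negative to positive. Past the
change the tail has nonnegative terms; before it, the complementary initial sum has nonpositive
terms and the two cancel. -/
lemma tail_nonneg (h : IsUltraLogConcave p c m s) (j : ℕ) : 0 ≤ tail p c m j := by
  rcases le_total (c j) m with hj | hj
  · refine tsum_nonneg fun i => mul_nonneg ?_ (h.pos _).le
    linarith [h.antitone (Nat.le_add_left j i)]
  · have h1 := h.sum_add_tail j
    have h2 : ∑ i ∈ Finset.range j, (m - c i) * p i ≤ 0 := by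
      refine Finset.sum_nonpos fun i hi => mul_nonpos_of_nonpos_of_nonneg ?_ (h.pos _).le
      linarith [h.antitone (Finset.mem_range.1 hi).le]
    linarith

lemma sum_tail (h : IsUltraLogConcave p c m s) (n : ℕ) :
    ∑ j ∈ Finset.range n, tail p c m (j + 1) =
      ∑ j ∈ Finset.range n, (j : ℝ) * ((m - c j) * p j) + n * tail p c m n := by
  induction n with
  | zero => simp
  | succ n ih =>
    rw [Finset.sum_range_succ, Finset.sum_range_succ, ih, h.tail_succ n]
    push_cast
    ring

/-- The boundary term of the summation by parts `sum_tail`; the factor n is absorbed by the index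
inside the tail, and the first moment converges absolutely. -/
lemma tendsto_mul_tail (h : IsUltraLogConcave p c m s) :
    Tendsto (fun n : ℕ => (n : ℝ) * tail p c m n) atTop (nhds 0) := by
  have h1 : Summable fun j : ℕ => |(j : ℝ) * ((m - c j) * p j)| := h.hasSum_mul_diff.summable.abs
  refine squeeze_zero (fun n => mul_nonneg n.cast_nonneg (h.tail_nonneg n)) (fun n => ?_)
    (tendsto_sum_nat_add fun j : ℕ => |(j : ℝ) * ((m - c j) * p j)|)
  rw [tail, ← tsum_mul_left]
  refine Summable.tsum_le_tsum (fun i => ?_)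
    (((summable_nat_add_iff n).2 h.hasSum_diff.summable).mul_left _) ((summable_nat_add_iff n).2 h1)
  calc (n : ℝ) * ((m - c (i + n)) * p (i + n)) ≤ n * |(m - c (i + n)) * p (i + n)| := by
        gcongr; exact le_abs_self _
    _ ≤ ((i + n : ℕ) : ℝ) * |(m - c (i + n)) * p (i + n)| := by
        gcongr; omega
    _ = _ := by rw [abs_mul (((i + n : ℕ) : ℝ)), Nat.abs_cast]

lemma hasSum_tail (h : IsUltraLogConcave p c m s) :
    HasSum (fun j => tail p c m (j + 1)) (m - (s - m ^ 2)) := by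
  rw [hasSum_iff_tendsto_nat_of_nonneg fun j => h.tail_nonneg _]
  simp_rw [h.sum_tail]
  simpa using h.hasSum_mul_diff.tendsto_sum_nat.add h.tendsto_mul_tail

end IsUltraLogConcave

/-! ### The Conway-Maxwell-Poisson law as a summable mass function -/

section cmp

variable {l ν : ℝ}

lemma cmp_weight_pos (hl : 0 < l) (j : ℕ) : 0 < l ^ j / ((j ! : ℕ) : ℝ) ^ ν := by
  have : 0 < ((j ! : ℕ) : ℝ) := by positivity
  positivity

lemma cmp_weight_le (hl : 0 < l) (hν : 1 ≤ ν) (j : ℕ) :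
    l ^ j / ((j ! : ℕ) : ℝ) ^ ν ≤ l ^ j / (j ! : ℕ) := by
  have h1 : (1 : ℝ) ≤ ((j ! : ℕ) : ℝ) := by exact_mod_cast Nat.one_le_iff_ne_zero.2 j.factorial_ne_zero
  gcongr
  simpa using Real.rpow_le_rpow_of_exponent_le h1 hν

lemma summable_cmp_weight (hl : 0 < l) (hν : 1 ≤ ν) :
    Summable fun j : ℕ => l ^ j / ((j ! : ℕ) : ℝ) ^ ν :=
  Summable.of_nonneg_of_le (fun j => (cmp_weight_pos hl j).le) (cmp_weight_le hl hν)
    (Real.summable_pow_div_factorial l)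

lemma cmpNormalizer_pos (hl : 0 < l) (hν : 1 ≤ ν) : 0 < cmpNormalizer l ν :=
  (summable_cmp_weight hl hν).tsum_pos (fun j => (cmp_weight_pos hl j).le) 0 (cmp_weight_pos hl 0)

lemma cmpMass_pos (hl : 0 < l) (hν : 1 ≤ ν) (j : ℕ) : 0 < cmpMass l ν j :=
  mul_pos (one_div_pos.2 (cmpNormalizer_pos hl hν)) (cmp_weight_pos hl j)

lemma hasSum_cmpMass (hl : 0 < l) (hν : 1 ≤ ν) : HasSum (cmpMass l ν) 1 := by
  have := (summable_cmp_weight hl hν).hasSum.mul_left (1 / cmpNormalizer l ν)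
  rwa [← cmpNormalizer, one_div_mul_cancel (cmpNormalizer_pos hl hν).ne'] at this

lemma rpow_mul_cmpMass_succ (l ν : ℝ) (j : ℕ) :
    ((j : ℝ) + 1) ^ ν * cmpMass l ν (j + 1) = l * cmpMass l ν j := by
  have h1 : 0 < ((j ! : ℕ) : ℝ) := by positivity
  have h2 : 0 < (j : ℝ) + 1 := by positivity
  have h3 := Real.rpow_pos_of_pos h1 ν
  have h4 := Real.rpow_pos_of_pos h2 ν
  rw [cmpMass, cmpMass, Nat.factorial_succ, Nat.cast_mul, Real.mul_rpow (by positivity) h1.le,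
    Nat.cast_add_one, pow_succ]
  field_simp

/-- Functions of at most exponential growth are summable against the mass function. -/
lemma summable_cmpMass_mul (hl : 0 < l) (hν : 1 ≤ ν) {f : ℕ → ℝ} {C a : ℝ} (_ha : 0 < a)
    (hf : ∀ j, |f j| ≤ C * a ^ j) : Summable fun j => f j * cmpMass l ν j := by
  have h1 : Summable fun j : ℕ => C * (1 / cmpNormalizer l ν) * ((l * a) ^ j / ((j ! : ℕ) : ℝ)) :=
    (Real.summable_pow_div_factorial (l * a)).mul_left _
  refine Summable.of_norm_bounded h1 fun j => ?_
  have hp := cmpMass_pos hl hν j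
  have hC : 0 ≤ C * a ^ j := (abs_nonneg _).trans (hf j)
  rw [Real.norm_eq_abs, abs_mul, abs_of_pos hp]
  calc |f j| * cmpMass l ν j ≤ C * a ^ j * (1 / cmpNormalizer l ν * (l ^ j / ((j ! : ℕ) : ℝ))) := by
        refine mul_le_mul (hf j) ?_ hp.le hC
        exact mul_le_mul_of_nonneg_left (cmp_weight_le hl hν j)
          (one_div_pos.2 (cmpNormalizer_pos hl hν)).le
    _ = _ := by rw [mul_pow]; ring

lemma natCast_pow_le (k j : ℕ) : ((j : ℝ)) ^ k ≤ (k ! : ℕ) * Real.exp 1 ^ j := by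
  rw [← Real.exp_nat_mul, mul_one]
  have := Real.pow_div_factorial_le_exp (j : ℝ) j.cast_nonneg k
  rwa [div_le_iff₀' (by positivity)] at this

lemma summable_pow_mul_cmpMass (hl : 0 < l) (hν : 1 ≤ ν) (k : ℕ) :
    Summable fun j : ℕ => (j : ℝ) ^ k * cmpMass l ν j :=
  summable_cmpMass_mul hl hν (Real.exp_pos 1) fun j => by
    rw [abs_of_nonneg (by positivity)]; exact natCast_pow_le k j

/-- The only place where `ν ≥ 1` gives monotonicity: the exponent `1 - ν` is nonpositive. -/
lemma isUltraLogConcave_cmpMass (hl : 0 < l) (hν : 1 ≤ ν) :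
    IsUltraLogConcave (cmpMass l ν) (fun j => l * ((j : ℝ) + 1) ^ (1 - ν))
      (∑' j : ℕ, (j : ℝ) * cmpMass l ν j) (∑' j : ℕ, (j : ℝ) ^ 2 * cmpMass l ν j) where
  pos := cmpMass_pos hl hν
  antitone i j hij := by
    have : (i : ℝ) ≤ j := by exact_mod_cast hij
    exact mul_le_mul_of_nonneg_left
      (Real.rpow_le_rpow_of_nonpos (by positivity) (by linarith) (by linarith)) hl.le
  rec_eq j := by
    have h2 : 0 < (j : ℝ) + 1 := by positivity
    have h3 := Real.rpow_pos_of_pos h2 ν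
    have := rpow_mul_cmpMass_succ l ν j
    rw [Real.rpow_sub h2, Real.rpow_one]
    field_simp
    linarith
  hasSum_one := hasSum_cmpMass hl hν
  hasSum_mean := by simpa using (summable_pow_mul_cmpMass hl hν 1).hasSum
  hasSum_sq := (summable_pow_mul_cmpMass hl hν 2).hasSum

lemma cmpMass_one (l : ℝ) (j : ℕ) : cmpMass l 1 j = Real.exp (-l) * l ^ j / (j ! : ℕ) := by
  have : cmpNormalizer l 1 = Real.exp l := by
    rw [Real.exp_eq_exp_ℝ, NormedSpace.exp_eq_tsum_div, cmpNormalizer]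
    simp
  rw [cmpMass, this, Real.rpow_one, Real.exp_neg]
  ring

/-- Poisson is the case `ν = 1`, so the formulas for sums and integrals serve both laws. -/
lemma poissonMeasure_eq_cmpMeasure (hl : 0 < l) : poissonMeasure l.toNNReal = cmpMeasure l 1 := by
  simp_rw [poissonMeasure, cmpMeasure, cmpMass_one, Real.coe_toNNReal _ hl.le]

lemma hasSum_pow_mul_poisson (l z : ℝ) :
    HasSum (fun j : ℕ => z ^ j * cmpMass l 1 j) (Real.exp (l * (z - 1))) := by
  have h := (NormedSpace.expSeries_div_hasSum_exp (l * z)).mul_left (Real.exp (-l))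
  rw [← Real.exp_eq_exp_ℝ, ← Real.exp_add] at h
  convert! h using 1
  · ext j; rw [cmpMass_one, mul_pow]; ring
  · ring_nf

lemma tsum_mul_poisson (hl : 0 < l) : ∑' j : ℕ, (j : ℝ) * cmpMass l 1 j = l := by
  have h := (isUltraLogConcave_cmpMass hl le_rfl).hasSum_coeff
  have h2 := (hasSum_cmpMass hl le_rfl).mul_left l
  simp only [sub_self, Real.rpow_zero, mul_one] at h h2
  exact h.unique h2

lemma integrable_cmpMeasure_iff (hl : 0 < l) (hν : 1 ≤ ν) {f : ℕ → ℝ} :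
    Integrable f (cmpMeasure l ν) ↔ Summable fun j => f j * cmpMass l ν j := by
  rw [cmpMeasure, integrable_sum_dirac_iff (by simp), ← summable_norm_iff (f := fun j => f j * _)]
  refine summable_congr fun j => ?_
  rw [ENNReal.toReal_ofReal (cmpMass_pos hl hν j).le, norm_mul,
    Real.norm_of_nonneg (cmpMass_pos hl hν j).le, mul_comm]

lemma integral_cmpMeasure (hl : 0 < l) (hν : 1 ≤ ν) (f : ℕ → ℝ) :
    ∫ j, f j ∂cmpMeasure l ν = ∑' j, f j * cmpMass l ν j := by
  rw [cmpMeasure, integral_sum_dirac (by simp)]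
  refine tsum_congr fun j => ?_
  rw [ENNReal.toReal_ofReal (cmpMass_pos hl hν j).le, smul_eq_mul, mul_comm]

lemma lintegral_cmpMeasure (l ν : ℝ) (f : ℕ → ℝ≥0∞) :
    ∫⁻ j, f j ∂cmpMeasure l ν = ∑' j, ENNReal.ofReal (cmpMass l ν j) * f j := by
  simp [cmpMeasure, lintegral_sum_measure]

lemma cmpMeasure_real (hl : 0 < l) (hν : 1 ≤ ν) (A : Set ℕ) :
    (cmpMeasure l ν).real A = ∑' j, A.indicator (fun _ => 1) j * cmpMass l ν j := by
  rw [← integral_cmpMeasure hl hν, ← integral_indicator_one MeasurableSet.of_discrete]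
  rfl

end cmp

/-! ### Stein's method for the Poisson law -/

section stein

variable {q χ : ℕ → ℝ} {m : ℝ}

/-- The mass that `q` gives to `{0, …, j}`, weighted by `χ`. -/
def partialMass (q χ : ℕ → ℝ) (j : ℕ) : ℝ := ∑ i ∈ Finset.range (j + 1), χ i * q i

/-- The solution `j ↦ f (j + 1)` of the Stein equation
`m * f (j + 1) - j * f j = χ j - ∑' i, χ i * q i` of the Poisson mass function `q` of mean `m`. -/
noncomputable def steinSolution (q χ : ℕ → ℝ) (m : ℝ) (j : ℕ) : ℝ :=
  (partialMass q χ j - (∑' i, χ i * q i) * partialMass q 1 j) / (m * q j)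

lemma partialMass_succ (q χ : ℕ → ℝ) (j : ℕ) :
    partialMass q χ (j + 1) = partialMass q χ j + χ (j + 1) * q (j + 1) :=
  Finset.sum_range_succ _ _

lemma partialMass_add_tsum (hs : Summable fun i => χ i * q i) (j : ℕ) :
    partialMass q χ j + ∑' i, χ (i + (j + 1)) * q (i + (j + 1)) = ∑' i, χ i * q i :=
  hs.sum_add_tsum_nat_add (j + 1)

variable (hm : 0 < m) (hq : ∀ j, 0 < q j) (hq1 : HasSum q 1)
  (hrec : ∀ j : ℕ, ((j : ℝ) + 1) * q (j + 1) = m * q j)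

include hq in
lemma partialMass_nonneg (hχ : ∀ j, 0 ≤ χ j) (j : ℕ) : 0 ≤ partialMass q χ j :=
  Finset.sum_nonneg fun i _ => mul_nonneg (hχ i) (hq i).le

include hq in
lemma partialMass_le (hχ : ∀ j, χ j ≤ 1) (j : ℕ) : partialMass q χ j ≤ partialMass q 1 j :=
  Finset.sum_le_sum fun i _ => mul_le_mul_of_nonneg_right (hχ i) (hq i).le

include hq hq1 in
lemma summable_mul_mass (hχ0 : ∀ j, 0 ≤ χ j) (hχ : ∀ j, χ j ≤ 1) : Summable fun i => χ i * q i :=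
  hq1.summable.of_nonneg_of_le (fun i => mul_nonneg (hχ0 i) (hq i).le)
    fun i => mul_le_of_le_one_left (hq i).le (hχ i)

include hq1 in
lemma one_sub_partialMass (j : ℕ) : 1 - partialMass q 1 j = ∑' i, q (i + (j + 1)) := by
  have h : Summable fun i => (1 : ℕ → ℝ) i * q i := by simpa using hq1.summable
  have := partialMass_add_tsum h j
  simp only [Pi.one_apply, one_mul, hq1.tsum_eq] at this
  linarith

include hq hq1 in
lemma one_sub_partialMass_nonneg (j : ℕ) : 0 ≤ 1 - partialMass q 1 j := by
  rw [one_sub_partialMass hq1]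
  exact tsum_nonneg fun i => (hq _).le

include hq hrec in
-- Termwise, `m * q i = (i + 1) * q (i + 1)` with `i + 1 ≤ j + 1`; the extra term at 0 is
-- nonnegative. The next bound is the same comparison on the upper tail, where the inequality
-- reverses.
lemma mul_partialMass_le (j : ℕ) :
    m * partialMass q 1 j ≤ ((j : ℝ) + 1) * partialMass q 1 (j + 1) := by
  rw [partialMass, partialMass, Finset.sum_range_succ' _ (j + 1), Finset.mul_sum, mul_add, Finset.mul_sum]
  have h0 : 0 ≤ ((j : ℝ) + 1) * ((1 : ℕ → ℝ) 0 * q 0) := by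
    have := (hq 0).le
    simp only [Pi.one_apply, one_mul]
    positivity
  have : ∑ i ∈ Finset.range (j + 1), m * ((1 : ℕ → ℝ) i * q i) ≤
      ∑ i ∈ Finset.range (j + 1), ((j : ℝ) + 1) * ((1 : ℕ → ℝ) (i + 1) * q (i + 1)) := by
    refine Finset.sum_le_sum fun i hi => ?_
    have hi : (i : ℝ) ≤ j := by exact_mod_cast Nat.lt_succ_iff.1 (Finset.mem_range.1 hi)
    simp only [Pi.one_apply, one_mul, ← hrec]
    have := (hq (i + 1)).le
    gcongr
  linarith

include hq hq1 hrec in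
lemma mul_one_sub_partialMass_le (j : ℕ) :
    ((j : ℝ) + 1) * (1 - partialMass q 1 (j + 1)) ≤ m * (1 - partialMass q 1 j) := by
  rw [one_sub_partialMass hq1, one_sub_partialMass hq1, ← tsum_mul_left, ← tsum_mul_left]
  refine Summable.tsum_le_tsum (fun i => ?_)
    (((summable_nat_add_iff (j + 1 + 1)).2 hq1.summable).mul_left _)
    (((summable_nat_add_iff (j + 1)).2 hq1.summable).mul_left _)
  rw [← hrec (i + (j + 1))]
  have := (hq (i + (j + 1 + 1))).le
  refine mul_le_mul_of_nonneg_right ?_ this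
  push_cast
  linarith [(Nat.cast_nonneg i : (0 : ℝ) ≤ i)]

include hm hq hrec in
lemma steinSolution_equation_succ (j : ℕ) :
    m * steinSolution q χ m (j + 1) - ((j : ℝ) + 1) * steinSolution q χ m j =
      χ (j + 1) - ∑' i, χ i * q i := by
  have h1 := (hq j).ne'
  have h2 := (hq (j + 1)).ne'
  have h3 : m * q j = ((j : ℝ) + 1) * q (j + 1) := (hrec j).symm
  have h4 : (j : ℝ) + 1 ≠ 0 := by positivity
  rw [steinSolution, steinSolution, partialMass_succ, partialMass_succ, h3]
  field_simp
  simp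
  ring

include hm hq in
lemma steinSolution_equation_zero :
    m * steinSolution q χ m 0 = χ 0 - ∑' i, χ i * q i := by
  have h1 := (hq 0).ne'
  simp only [steinSolution, partialMass, zero_add, Finset.range_one, Finset.sum_singleton,
    Pi.one_apply, one_mul]
  field_simp

include hm hq hq1 hrec in
/-- The Stein factor bound for the Poisson distribution. -/
lemma steinSolution_sub_le (hχ0 : ∀ j, 0 ≤ χ j) (hχ : ∀ j, χ j ≤ 1) (j : ℕ) :
    steinSolution q χ m (j + 1) - steinSolution q χ m j ≤ 1 / m := by
  have hs := summable_mul_mass hq hq1 hχ0 hχ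
  have hb : 0 ≤ (∑' i, χ i * q i) - partialMass q χ (j + 1) := by
    rw [← partialMass_add_tsum hs (j + 1), add_sub_cancel_left]
    exact tsum_nonneg fun i => mul_nonneg (hχ0 _) (hq _).le
  have ha := partialMass_nonneg hq hχ0 j
  have hF := mul_partialMass_le hq hrec j
  have hG := mul_one_sub_partialMass_le hq hq1 hrec j
  have e1 := partialMass_succ q χ j
  have e2 := partialMass_succ q 1 j
  have hj : 0 < (j : ℝ) + 1 := by positivity
  have h1 := hq j
  have h2 := hq (j + 1)
  have h3 : m * q j = ((j : ℝ) + 1) * q (j + 1) := (hrec j).symm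
  have h4 : q (j + 1) = m * q j / ((j : ℝ) + 1) := by rw [h3]; field_simp
  have hx0 := hχ0 (j + 1)
  have hx1 := hχ (j + 1)
  simp only [Pi.one_apply, one_mul] at e2
  rw [steinSolution, steinSolution]
  set Q := ∑' i, χ i * q i
  set a := partialMass q χ j
  set a' := partialMass q χ (j + 1)
  set F := partialMass q 1 j
  set F' := partialMass q 1 (j + 1)
  -- Split Q into the χ-mass below, at and above `j + 1`. The masses below and above enter with
  -- nonpositive coefficients (`k1`, `k2`); the mass at `j + 1` contributes at most `(j + 1) * q (j
  -- + 1)` (`k3`, `k4`).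
  have key : ((j : ℝ) + 1) * (a' - Q * F') - m * (a - Q * F) ≤ m * q j := by
    have k1 : 0 ≤ a * (m * (1 - F) - ((j : ℝ) + 1) * (1 - F')) := mul_nonneg ha (by linarith)
    have k2 : 0 ≤ (Q - a') * (((j : ℝ) + 1) * F' - m * F) := mul_nonneg hb (by linarith)
    have k3 : 0 ≤ χ (j + 1) * q (j + 1) * (((j : ℝ) + 1) * F' - m * F) :=
      mul_nonneg (by positivity) (by linarith)
    have k4 : 0 ≤ (1 - χ (j + 1)) * (((j : ℝ) + 1) * q (j + 1)) :=
      mul_nonneg (by linarith) (by positivity)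
    rw [h3]
    rw [e1] at k2 ⊢
    linear_combination k1 + k2 + k3 + k4
  have : (a' - Q * F') / (m * q (j + 1)) - (a - Q * F) / (m * q j) =
      (((j : ℝ) + 1) * (a' - Q * F') - m * (a - Q * F)) / (m ^ 2 * q j) := by
    rw [h4]; field_simp
  rw [this, div_le_div_iff₀ (by positivity) hm]
  nlinarith

include hm hq hq1 hrec in
-- A crude bound uniform in j, needed only for the summability of the series in the Stein argument.
lemma abs_steinSolution_le (hχ0 : ∀ j, 0 ≤ χ j) (hχ : ∀ j, χ j ≤ 1) (j : ℕ) :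
    |steinSolution q χ m j| ≤ 1 / (m * q 0) := by
  have hs := summable_mul_mass hq hq1 hχ0 hχ
  -- The ratio of upper tail to mass is nonincreasing in j.
  have hG : (1 - partialMass q 1 j) / q j ≤ 1 / q 0 := by
    induction j with
    | zero =>
      have := partialMass_nonneg (χ := 1) hq (by simp) 0
      have h0 := hq 0
      gcongr
      linarith
    | succ j ih =>
      refine le_trans ?_ ih
      rw [div_le_div_iff₀ (hq _) (hq _)]
      have h2 := mul_one_sub_partialMass_le hq hq1 hrec j
      have h3 := mul_le_mul_of_nonneg_right h2 (hq (j + 1)).le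
      have hj : 0 < (j : ℝ) + 1 := by positivity
      have h4 := hrec j
      refine le_of_mul_le_mul_left ?_ hm
      calc m * ((1 - partialMass q 1 (j + 1)) * q j)
          = (1 - partialMass q 1 (j + 1)) * (m * q j) := by ring
        _ = (j + 1) * (1 - partialMass q 1 (j + 1)) * q (j + 1) := by rw [← h4]; ring
        _ ≤ _ := by linarith
  have hb : 0 ≤ (∑' i, χ i * q i) - partialMass q χ j := by
    rw [← partialMass_add_tsum hs j, add_sub_cancel_left]
    exact tsum_nonneg fun i => mul_nonneg (hχ0 _) (hq _).le
  have hb' : (∑' i, χ i * q i) - partialMass q χ j ≤ 1 - partialMass q 1 j := by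
    rw [← partialMass_add_tsum hs j, add_sub_cancel_left, one_sub_partialMass hq1]
    exact ((summable_nat_add_iff (j + 1)).2 hs).tsum_le_tsum
      (fun i => mul_le_of_le_one_left (hq _).le (hχ _)) ((summable_nat_add_iff (j + 1)).2 hq1.summable)
  have ha := partialMass_nonneg hq hχ0 j
  have ha' := partialMass_le hq hχ j
  have hF0 := ha.trans ha'
  have hF1 := one_sub_partialMass_nonneg hq hq1 j
  have h0 := hq j
  rw [steinSolution, abs_div, abs_of_pos (mul_pos hm h0)]
  set Q := ∑' i, χ i * q i
  set a := partialMass q χ j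
  set F := partialMass q 1 j
  have key : |a - Q * F| ≤ 1 - F := by
    rw [abs_le]
    constructor <;> nlinarith
  calc |a - Q * F| / (m * q j) ≤ (1 - F) / (m * q j) := by gcongr
    _ = 1 / m * ((1 - F) / q j) := by field_simp
    _ ≤ 1 / m * (1 / q 0) := by gcongr
    _ = _ := by field_simp

variable {p c : ℕ → ℝ} {s : ℝ}

include hq hq1 hrec in
/-- One half of the total variation bound for an ultra log-concave law. -/
lemma IsUltraLogConcave.tsum_sub_le (h : IsUltraLogConcave p c m s)
    (hχ0 : ∀ j, 0 ≤ χ j) (hχ : ∀ j, χ j ≤ 1) :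
    ∑' j, χ j * p j - ∑' j, χ j * q j ≤ 1 / m * (m - (s - m ^ 2)) := by
  have hm := h.mean_pos
  set Q := ∑' j, χ j * q j
  set g := steinSolution q χ m with hg
  set D := IsUltraLogConcave.tail p c m
  have hb : ∀ j, ‖g j‖ ≤ 1 / (m * q 0) := abs_steinSolution_le hm hq hq1 hrec hχ0 hχ
  have hbdd : ∀ {f : ℕ → ℝ}, Summable f → (∀ j, 0 ≤ f j) → Summable fun j => g j * f j := by
    intro f hf hf0
    refine Summable.of_norm_bounded (hf.mul_left (1 / (m * q 0))) fun j => ?_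
    rw [norm_mul, Real.norm_of_nonneg (hf0 j)]
    exact mul_le_mul_of_nonneg_right (hb j) (hf0 j)
  have hc0 : ∀ j, 0 ≤ c j * p j := fun j => by
    rw [← h.rec_eq]; have := (h.pos (j + 1)).le; positivity
  have s1 : Summable fun j => g j * p j := hbdd h.hasSum_one.summable fun j => (h.pos j).le
  have s2 : Summable fun j => g j * (c j * p j) := hbdd h.hasSum_coeff.summable hc0
  have s3 : Summable fun j => g j * D (j + 1) := hbdd h.hasSum_tail.summable fun j => h.tail_nonneg _
  have sD : Summable fun j => g j * D j :=
    hbdd ((summable_nat_add_iff 1).1 h.hasSum_tail.summable) h.tail_nonneg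
  have s4 : Summable fun j => g (j + 1) * D (j + 1) :=
    (summable_nat_add_iff (f := fun j => g j * D j) 1).2 sD
  have e1 : ∑' j, χ j * p j - Q = ∑' j, (χ j - Q) * p j := by
    have := (summable_mul_mass h.pos h.hasSum_one hχ0 hχ).tsum_sub (h.hasSum_one.summable.mul_left Q)
    simp only [sub_mul]
    rw [this, tsum_mul_left, h.hasSum_one.tsum_eq, mul_one]
  have e2 : ∀ j : ℕ, (χ (j + 1) - Q) * p (j + 1) = m * (g (j + 1) * p (j + 1)) - g j * (c j * p j) := by
    intro j
    rw [← steinSolution_equation_succ hm hq hrec j, ← h.rec_eq j]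
    ring
  -- The Stein equation averaged under p; the recursion replaces `(j + 1) * p (j + 1)` by `c j * p
  -- j`.
  have e3 : ∑' j, (χ j - Q) * p j = ∑' j, g j * ((m - c j) * p j) := by
    have t1 : Summable fun j => (χ j - Q) * p j := by
      have := (summable_mul_mass h.pos h.hasSum_one hχ0 hχ).sub (h.hasSum_one.summable.mul_left Q)
      simpa only [sub_mul] using this
    rw [t1.tsum_eq_zero_add]
    simp only [e2]
    have t2 := ((summable_nat_add_iff 1).2 s1).mul_left m
    rw [t2.tsum_sub s2, tsum_mul_left, ← steinSolution_equation_zero hm hq,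
      ← hg]
    have t3 : ∀ j, g j * ((m - c j) * p j) = m * (g j * p j) - g j * (c j * p j) := fun j => by ring
    simp only [t3]
    rw [(s1.mul_left m).tsum_sub s2, tsum_mul_left, s1.tsum_eq_zero_add]
    ring
  -- Summation by parts; the boundary term vanishes because the whole tail `D 0` is zero.
  have e4 : ∑' j, g j * ((m - c j) * p j) = ∑' j, (g (j + 1) - g j) * D (j + 1) := by
    have t1 : ∀ j, g j * ((m - c j) * p j) = g j * D j - g j * D (j + 1) := fun j => by
      rw [show D j = _ from h.tail_succ j]; ring
    simp only [t1]
    simp only [sub_mul]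
    rw [sD.tsum_sub s3, s4.tsum_sub s3, sD.tsum_eq_zero_add, show D 0 = 0 from h.tail_zero]
    ring
  rw [e1, e3, e4, ← h.hasSum_tail.tsum_eq, ← tsum_mul_left]
  refine Summable.tsum_le_tsum (fun j => mul_le_mul_of_nonneg_right ?_ (h.tail_nonneg _)) ?_
    (h.hasSum_tail.summable.mul_left _)
  · exact steinSolution_sub_le hm hq hq1 hrec hχ0 hχ j
  · simpa only [sub_mul] using s4.sub s3

include hq hq1 hrec in
-- Replacing χ by `1 - χ` flips the sign of the difference, as both laws have mass one.
lemma IsUltraLogConcave.abs_tsum_sub_le (h : IsUltraLogConcave p c m s)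
    (hχ0 : ∀ j, 0 ≤ χ j) (hχ : ∀ j, χ j ≤ 1) :
    |∑' j, χ j * p j - ∑' j, χ j * q j| ≤ 1 / m * (m - (s - m ^ 2)) := by
  have h1 := h.tsum_sub_le hq hq1 hrec hχ0 hχ
  have h2 := h.tsum_sub_le (χ := fun j => 1 - χ j) hq hq1 hrec (fun j => by linarith [hχ j])
    (fun j => by linarith [hχ0 j])
  simp only [sub_mul, one_mul] at h2
  rw [h.hasSum_one.summable.tsum_sub (summable_mul_mass h.pos h.hasSum_one hχ0 hχ),
    hq1.summable.tsum_sub (summable_mul_mass hq hq1 hχ0 hχ), h.hasSum_one.tsum_eq,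
    hq1.tsum_eq] at h2
  rw [abs_le]
  constructor <;> linarith

end stein

/-! ### The Poincaré inequality by paths -/

section poincare

variable {p c : ℕ → ℝ} {m s : ℝ}

/-- A weighted sum over the increments of `g`, in the path from `i` up to `k`. -/
noncomputable def pathWeight (g : ℕ → ℝ) (i k j : ℕ) : ℝ≥0∞ :=
  if i ≤ j ∧ j < k then ENNReal.ofReal ((k : ℝ) - i) * ENNReal.ofReal ((g (j + 1) - g j) ^ 2) else 0

/-- Cauchy-Schwarz on the telescoping sum of the `k - i` increments. -/
lemma sq_sub_le_tsum_pathWeight (g : ℕ → ℝ) {i k : ℕ} (hik : i ≤ k) :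
    ENNReal.ofReal ((g i - g k) ^ 2) ≤ ∑' j, pathWeight g i k j := by
  have hki : (0 : ℝ) ≤ (k : ℝ) - i := sub_nonneg.2 (by exact_mod_cast hik)
  have h1 : (g i - g k) ^ 2 ≤
      ∑ j ∈ Finset.Ico i k, ((k : ℝ) - i) * (g (j + 1) - g j) ^ 2 := by
    have h2 : ∑ j ∈ Finset.Ico i k, (g (j + 1) - g j) = g k - g i := Finset.sum_Ico_sub g hik
    have h3 := sq_sum_le_card_mul_sum_sq (s := Finset.Ico i k) (f := fun j => g (j + 1) - g j)
    rw [h2, Nat.card_Ico, Nat.cast_sub hik] at h3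
    rw [← Finset.mul_sum]
    linarith [sub_sq_comm (g i) (g k)]
  refine (ENNReal.ofReal_le_ofReal h1).trans ?_
  rw [ENNReal.ofReal_sum_of_nonneg fun j _ => by positivity]
  refine le_trans (le_of_eq (Finset.sum_congr rfl fun j hj => ?_))
    (ENNReal.sum_le_tsum (Finset.Ico i k))
  rw [pathWeight, if_pos (Finset.mem_Ico.1 hj), ENNReal.ofReal_mul hki]

lemma sq_sub_le_tsum_pathWeight_add (g : ℕ → ℝ) (i k : ℕ) :
    ENNReal.ofReal ((g i - g k) ^ 2) ≤ ∑' j, (pathWeight g i k j + pathWeight g k i j) := by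
  rcases le_total i k with h | h
  · exact (sq_sub_le_tsum_pathWeight g h).trans (ENNReal.tsum_le_tsum fun j => le_self_add)
  · rw [sub_sq_comm]
    exact (sq_sub_le_tsum_pathWeight g h).trans (ENNReal.tsum_le_tsum fun j => le_add_self)

namespace IsUltraLogConcave

/-- By the recursion the left side equals `m * p j` minus the tail at j. -/
lemma mul_sum_sub_le (h : IsUltraLogConcave p c m s) (j : ℕ) :
    m * ∑ i ∈ Finset.range (j + 1), p i - ∑ i ∈ Finset.range (j + 1), (i : ℝ) * p i ≤ m * p j := by
  have h1 := h.sum_add_tail j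
  have h2 := h.tail_nonneg j
  rw [Finset.sum_range_succ, Finset.sum_range_succ' _ j]
  simp only [sub_mul, Finset.sum_sub_distrib, ← Finset.mul_sum, ← h.rec_eq] at h1
  push_cast
  linarith

lemma hasSum_ite_lt (h : IsUltraLogConcave p c m s) (i j : ℕ) :
    HasSum (fun k : ℕ => if j < k then ((k : ℝ) - i) * p k else 0)
      ((m - ∑ k ∈ Finset.range (j + 1), (k : ℝ) * p k) -
        i * (1 - ∑ k ∈ Finset.range (j + 1), p k)) := by
  have h1 := h.hasSum_mean.sub (h.hasSum_one.mul_left (i : ℝ))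
  have h2 : HasSum (fun k : ℕ => if k ∈ Finset.range (j + 1) then ((k : ℝ) * p k - i * p k) else 0)
      (∑ k ∈ Finset.range (j + 1), ((k : ℝ) * p k - i * p k)) := by
    have h3 := hasSum_sum_of_ne_finset_zero (L := .unconditional ℕ) (s := Finset.range (j + 1))
      (f := fun k : ℕ => if k ∈ Finset.range (j + 1) then ((k : ℝ) * p k - i * p k) else 0)
      (fun b hb => if_neg hb)
    rwa [Finset.sum_congr rfl fun k hk => if_pos hk] at h3
  convert! h1.sub h2 using 1
  · ext k
    by_cases hk : j < k
    · rw [if_pos hk, if_neg (by simp; omega)]; ring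
    · rw [if_neg hk, if_pos (by simp; omega)]; ring
  · rw [Finset.sum_sub_distrib, ← Finset.mul_sum]; ring

/-- The mean length of the paths that cross the edge from j to `j + 1` upwards. With F and M the
mass and first moment on `{0, …, j}`, it is `F (m - M) - M (1 - F) = m F - M`, which
`mul_sum_sub_le` bounds. -/
lemma tsum_tsum_ite_le (h : IsUltraLogConcave p c m s) (j : ℕ) :
    ∑' i, ∑' k, (if i ≤ j ∧ j < k then
      ENNReal.ofReal (p i) * (ENNReal.ofReal (p k) * ENNReal.ofReal ((k : ℝ) - i)) else 0) ≤
      ENNReal.ofReal (m * p j) := by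
  set F := ∑ k ∈ Finset.range (j + 1), p k with hF
  set M := ∑ k ∈ Finset.range (j + 1), (k : ℝ) * p k with hM
  have h0 : ∀ i ≤ j, ∀ k : ℕ, 0 ≤ if j < k then ((k : ℝ) - i) * p k else 0 := by
    intro i hi k
    split_ifs with hk
    · have : (i : ℝ) ≤ k := by exact_mod_cast (hi.trans hk.le)
      exact mul_nonneg (by linarith) (h.pos k).le
    · exact le_rfl
  have h1 : ∀ i ≤ j, ∑' k, (if i ≤ j ∧ j < k then
      ENNReal.ofReal (p i) * (ENNReal.ofReal (p k) * ENNReal.ofReal ((k : ℝ) - i)) else 0) =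
      ENNReal.ofReal (p i * ((m - M) - i * (1 - F))) := by
    intro i hi
    have hs := h.hasSum_ite_lt i j
    rw [ENNReal.ofReal_mul (h.pos i).le, ← hs.tsum_eq,
      ENNReal.ofReal_tsum_of_nonneg (h0 i hi) hs.summable, ← ENNReal.tsum_mul_left]
    refine tsum_congr fun k => ?_
    by_cases hk : j < k
    · rw [if_pos ⟨hi, hk⟩, if_pos hk, mul_comm ((k : ℝ) - i), ENNReal.ofReal_mul (h.pos k).le]
    · rw [if_neg fun hh => hk hh.2, if_neg hk]; simp
  rw [tsum_eq_sum (s := Finset.range (j + 1))]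
  · rw [Finset.sum_congr rfl fun i hi => h1 i (Nat.lt_succ_iff.1 (Finset.mem_range.1 hi)),
      ← ENNReal.ofReal_sum_of_nonneg]
    · refine ENNReal.ofReal_le_ofReal ?_
      have h2 : ∑ i ∈ Finset.range (j + 1), p i * ((m - M) - i * (1 - F)) =
          F * (m - M) - M * (1 - F) := by
        rw [hF, hM, Finset.sum_mul, Finset.sum_mul, ← Finset.sum_sub_distrib]
        exact Finset.sum_congr rfl fun i _ => by ring
      rw [h2]
      linarith [h.mul_sum_sub_le j]
    · intro i hi
      have hi := Nat.lt_succ_iff.1 (Finset.mem_range.1 hi)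
      exact mul_nonneg (h.pos i).le ((h.hasSum_ite_lt i j).nonneg (h0 i hi))
  · intro i hi
    have hi : ¬ i ≤ j := by simpa [Nat.lt_succ_iff] using hi
    simp [hi]

lemma tsum_ofReal (h : IsUltraLogConcave p c m s) : ∑' i, ENNReal.ofReal (p i) = 1 := by
  rw [← ENNReal.ofReal_tsum_of_nonneg (fun i => (h.pos i).le) h.hasSum_one.summable,
    h.hasSum_one.tsum_eq, ENNReal.ofReal_one]

/-- Expanding the square, the cross term vanishes because g has mean zero. -/
lemma two_mul_tsum_sq (h : IsUltraLogConcave p c m s) {g : ℕ → ℝ}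
    (hg : Summable fun j => g j ^ 2 * p j) (hg0 : HasSum (fun j => g j * p j) 0) :
    ∑' i, ∑' k, ENNReal.ofReal (p i) * (ENNReal.ofReal (p k) * ENNReal.ofReal ((g i - g k) ^ 2)) =
      2 * ∑' i, ENNReal.ofReal (p i) * ENNReal.ofReal (g i ^ 2) := by
  set V := ∑' j, g j ^ 2 * p j with hV
  have hg2 : ∀ j, 0 ≤ g j ^ 2 * p j := fun j => mul_nonneg (sq_nonneg _) (h.pos j).le
  have hV0 : 0 ≤ V := tsum_nonneg hg2
  have hVe : ∑' i, ENNReal.ofReal (p i) * ENNReal.ofReal (g i ^ 2) = ENNReal.ofReal V := by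
    rw [hV, ENNReal.ofReal_tsum_of_nonneg hg2 hg]
    exact tsum_congr fun i => by rw [mul_comm, ENNReal.ofReal_mul (sq_nonneg _)]
  have h1 : ∀ i, ∑' k, ENNReal.ofReal (p k) * ENNReal.ofReal ((g i - g k) ^ 2) =
      ENNReal.ofReal (g i ^ 2) + ENNReal.ofReal V := by
    intro i
    have hs : HasSum (fun k => (g i - g k) ^ 2 * p k) (g i ^ 2 + V) := by
      convert! ((h.hasSum_one.mul_left (g i ^ 2)).sub (hg0.mul_left (2 * g i))).add hg.hasSum using 1
      · ext k; ring
      · ring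
    rw [← ENNReal.ofReal_add (sq_nonneg _) hV0, ← hs.tsum_eq,
      ENNReal.ofReal_tsum_of_nonneg (fun k => mul_nonneg (sq_nonneg _) (h.pos k).le) hs.summable]
    exact tsum_congr fun k => by rw [mul_comm, ENNReal.ofReal_mul (sq_nonneg _)]
  simp only [ENNReal.tsum_mul_left, h1, mul_add]
  rw [ENNReal.tsum_add, ENNReal.tsum_mul_right, h.tsum_ofReal, hVe, one_mul, two_mul]

/-- The Poincaré inequality for an ultra log-concave law. -/
lemma tsum_sq_le (h : IsUltraLogConcave p c m s) {g : ℕ → ℝ}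
    (hg : Summable fun j => g j ^ 2 * p j) (hg0 : HasSum (fun j => g j * p j) 0) :
    ∑' i, ENNReal.ofReal (p i) * ENNReal.ofReal (g i ^ 2) ≤
      ENNReal.ofReal m * ∑' j, ENNReal.ofReal (p j) * ENNReal.ofReal ((g (j + 1) - g j) ^ 2) := by
  set w : ℕ → ℝ≥0∞ := fun i => ENNReal.ofReal (p i) with hw
  set T : ℝ≥0∞ := ∑' j, ∑' i, ∑' k, w i * (w k * pathWeight g i k j) with hT
  have h1 : ∑' i, ∑' k, w i * (w k * ENNReal.ofReal ((g i - g k) ^ 2)) ≤ 2 * T := by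
    calc ∑' i, ∑' k, w i * (w k * ENNReal.ofReal ((g i - g k) ^ 2))
        ≤ ∑' i, ∑' k, w i * (w k * ∑' j, (pathWeight g i k j + pathWeight g k i j)) :=
          ENNReal.tsum_le_tsum fun i => ENNReal.tsum_le_tsum fun k => by
            gcongr; exact sq_sub_le_tsum_pathWeight_add g i k
      _ = ∑' i, ∑' k, ∑' j, w i * (w k * pathWeight g i k j) +
          ∑' i, ∑' k, ∑' j, w i * (w k * pathWeight g k i j) := by
          simp only [ENNReal.tsum_add, mul_add, ENNReal.tsum_mul_left]
      _ = ∑' i, ∑' k, ∑' j, w i * (w k * pathWeight g i k j) +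
          ∑' i, ∑' k, ∑' j, w i * (w k * pathWeight g i k j) := by
          congr 1
          rw [ENNReal.tsum_comm]
          exact tsum_congr fun k => tsum_congr fun i => tsum_congr fun j => mul_left_comm _ _ _
      _ = 2 * T := by
          rw [← two_mul, hT]
          congr 1
          calc ∑' i, ∑' k, ∑' j, w i * (w k * pathWeight g i k j)
              = ∑' i, ∑' j, ∑' k, w i * (w k * pathWeight g i k j) :=
                tsum_congr fun i => ENNReal.tsum_comm
            _ = _ := ENNReal.tsum_comm
  -- With the edge j outermost, its squared increment factors out of the sum over pairs.
  have h2 : T ≤ ENNReal.ofReal m * ∑' j, w j * ENNReal.ofReal ((g (j + 1) - g j) ^ 2) := by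
    rw [← ENNReal.tsum_mul_left]
    refine ENNReal.tsum_le_tsum fun j => ?_
    rw [← mul_assoc, hw, ← ENNReal.ofReal_mul h.mean_pos.le]
    refine le_trans (le_of_eq ?_) (mul_le_mul_left (h.tsum_tsum_ite_le j) _)
    simp only [← ENNReal.tsum_mul_right]
    refine tsum_congr fun i => tsum_congr fun k => ?_
    rw [pathWeight]
    split_ifs <;> simp [mul_assoc]
  rw [h.two_mul_tsum_sq hg hg0] at h1
  exact ((ENNReal.mul_le_mul_iff_right (by simp) (by simp)).1 h1).trans h2

end IsUltraLogConcave

end poincare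

/-! ### Convex order by crossing of mass functions -/

section convexOrder

/-- The three-chord inequality, without denominators. -/
lemma ConvexOn.sub_mul_le {f : ℝ → ℝ} (hf : ConvexOn ℝ Set.univ f) {x y z : ℝ} (hxy : x < y)
    (hyz : y < z) : (z - x) * f y ≤ (z - y) * f x + (y - x) * f z := by
  have h := hf.slope_mono_adjacent (Set.mem_univ x) (Set.mem_univ z) hxy hyz
  rw [div_le_div_iff₀ (by linarith) (by linarith)] at h
  linarith

lemma ConvexOn.le_chord {f : ℝ → ℝ} (hf : ConvexOn ℝ Set.univ f) {a b x : ℝ} (hax : a < x)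
    (hxb : x < b) : f x - (f a + (f b - f a) / (b - a) * (x - a)) ≤ 0 := by
  have hab : 0 < b - a := by linarith
  have h := hf.sub_mul_le hax hxb
  refine nonpos_of_mul_nonpos_right (a := b - a) ?_ hab
  field_simp
  linarith

lemma ConvexOn.chord_le_left {f : ℝ → ℝ} (hf : ConvexOn ℝ Set.univ f) {a b x : ℝ} (hxa : x ≤ a)
    (hab : a < b) : 0 ≤ f x - (f a + (f b - f a) / (b - a) * (x - a)) := by
  rcases hxa.eq_or_lt with rfl | hxa
  · simp
  have hab' : 0 < b - a := by linarith
  have h := hf.sub_mul_le hxa hab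
  refine nonneg_of_mul_nonneg_right (a := b - a) ?_ hab'
  field_simp
  linarith

lemma ConvexOn.chord_le_right {f : ℝ → ℝ} (hf : ConvexOn ℝ Set.univ f) {a b x : ℝ} (hbx : b ≤ x)
    (hab : a < b) : 0 ≤ f x - (f a + (f b - f a) / (b - a) * (x - a)) := by
  have hab' : 0 < b - a := by linarith
  rcases hbx.eq_or_lt with rfl | hbx
  · rw [div_mul_cancel₀ _ hab'.ne']; simp
  have h := hf.sub_mul_le hab hbx
  refine nonneg_of_mul_nonneg_right (a := b - a) ?_ hab'
  field_simp
  linarith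

variable {p c q : ℕ → ℝ} {m s : ℝ} (hq : ∀ j, 0 < q j) (hq1 : HasSum q 1)
  (hqm : HasSum (fun j : ℕ => (j : ℝ) * q j) m)
  (hrec : ∀ j : ℕ, ((j : ℝ) + 1) * q (j + 1) = m * q j)

namespace IsUltraLogConcave

/-- If `c` stayed above m, the mean of `c`, which is m, would exceed m. -/
lemma exists_coeff_le (h : IsUltraLogConcave p c m s) : ∃ n, c n ≤ m ∧ ∀ i < n, m ≤ c i := by
  classical
  have hex : ∃ n, c n ≤ m := by
    by_contra! hc
    have h1 : HasSum (fun j => (c j - m) * p j) 0 := by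
      simpa [← neg_mul] using h.hasSum_diff.neg
    have h2 := (hasSum_zero_iff_of_nonneg fun j => mul_nonneg (sub_nonneg.2 (hc j).le) (h.pos j).le).1 h1
    have h3 := congrFun h2 0
    have h4 := mul_pos (sub_pos.2 (hc 0)) (h.pos 0)
    simp only [Pi.zero_apply] at h3
    linarith
  exact ⟨Nat.find hex, Nat.find_spec hex, fun i hi => (not_le.1 (Nat.find_min hex hi)).le⟩

include hq hrec in
lemma ratio_succ (h : IsUltraLogConcave p c m s) (j : ℕ) :
    p (j + 1) / q (j + 1) = p j / q j * (c j / m) := by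
  have h1 := h.rec_eq j
  have h2 := hrec j
  have h3 := (hq j).ne'
  have h4 := (hq (j + 1)).ne'
  have h5 := h.mean_pos.ne'
  have h6 : (j : ℝ) + 1 ≠ 0 := by positivity
  have h7 : p (j + 1) = c j * p j / ((j : ℝ) + 1) := by rw [← h1]; field_simp
  have h8 : q (j + 1) = m * q j / ((j : ℝ) + 1) := by rw [← h2]; field_simp
  rw [h7, h8]
  field_simp

include hq hrec in
/-- The likelihood ratio with respect to the Poisson law is unimodal. -/
lemma exists_unimodal (h : IsUltraLogConcave p c m s) :
    ∃ n, (∀ i j, i ≤ j → j ≤ n → p i / q i ≤ p j / q j) ∧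
      ∀ i j, n ≤ i → i ≤ j → p j / q j ≤ p i / q i := by
  obtain ⟨n, hn, hlt⟩ := h.exists_coeff_le
  have hm := h.mean_pos
  have hr : ∀ j, 0 ≤ p j / q j := fun j => (div_pos (h.pos j) (hq j)).le
  refine ⟨n, fun i j hij => ?_, fun i j hi hij => ?_⟩
  · induction j, hij using Nat.le_induction with
    | base => intro _; exact le_rfl
    | succ j hij ih =>
      intro hj
      refine (ih (by omega)).trans ?_
      rw [h.ratio_succ hq hrec]
      exact le_mul_of_one_le_right (hr j) ((one_le_div hm).2 (hlt j (by omega)))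
  · induction j, hij using Nat.le_induction with
    | base => exact le_rfl
    | succ j hij ih =>
      refine le_trans ?_ ih
      rw [h.ratio_succ hq hrec]
      exact mul_le_of_le_one_right (hr j)
        ((div_le_one hm).2 ((h.antitone (hi.trans hij)).trans hn))

include hq hrec in
-- The likelihood ratio is bounded by its value at the mode; this transfers summability from q to p.
lemma exists_le_mul (h : IsUltraLogConcave p c m s) : ∃ C, 0 ≤ C ∧ ∀ j, p j ≤ C * q j := by
  obtain ⟨n, h1, h2⟩ := h.exists_unimodal hq hrec
  refine ⟨p n / q n, (div_pos (h.pos n) (hq n)).le, fun j => ?_⟩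
  rw [← div_le_iff₀ (hq j)]
  rcases le_total j n with hj | hj
  · exact h1 j n hj le_rfl
  · exact h2 n j le_rfl hj

include hq hq1 hqm hrec in
/-- Either the law is Poisson, or its mass function exceeds the Poisson one exactly between two
crossing points. -/
lemma exists_crossing (h : IsUltraLogConcave p c m s) :
    (∀ j, p j = q j) ∨ ∃ a b : ℝ, a < b ∧ (∀ j : ℕ, (j : ℝ) ≤ a → p j ≤ q j) ∧
      (∀ j : ℕ, a < (j : ℝ) → (j : ℝ) < b → q j ≤ p j) ∧ ∀ j : ℕ, b ≤ (j : ℝ) → p j ≤ q j := by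
  classical
  obtain ⟨n, h1, h2⟩ := h.exists_unimodal hq hrec
  have hle : ∀ j, p j / q j ≤ 1 ↔ p j ≤ q j := fun j => div_le_one (hq j)
  have hlt : ∀ j, 1 < p j / q j ↔ q j < p j := fun j => one_lt_div (hq j)
  -- A maximal ratio at most one gives `p ≤ q` everywhere, hence equality by total mass.
  by_cases hn : p n / q n ≤ 1
  · left
    have h3 : ∀ j, p j ≤ q j := fun j => by
      rw [← hle]
      rcases le_total j n with hj | hj
      · exact (h1 j n hj le_rfl).trans hn
      · exact (h2 n j le_rfl hj).trans hn
    have h4 := hq1.sub h.hasSum_one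
    rw [sub_self] at h4
    have h5 := (hasSum_zero_iff_of_nonneg fun j => sub_nonneg.2 (h3 j)).1 h4
    intro j
    have := congrFun h5 j
    simp only [Pi.zero_apply] at this
    linarith
  · right
    rw [not_le] at hn
    have hex : ∃ j, 1 < p j / q j := ⟨n, hn⟩
    set k := Nat.find hex with hk
    have hkn : k ≤ n := Nat.find_min' hex hn
    have hk1 : 1 < p k / q k := Nat.find_spec hex
    have hleft : ∀ j : ℕ, (j : ℝ) ≤ (k : ℝ) - 1 → p j ≤ q j := by
      intro j hj
      have hj' : j < k := by
        have : (j : ℝ) < k := by linarith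
        exact_mod_cast this
      rw [← hle]
      exact not_lt.1 (Nat.find_min hex hj')
    have hmid : ∀ j : ℕ, (k : ℝ) - 1 < j → j ≤ n → q j ≤ p j := by
      intro j hj hjn
      have hj' : k ≤ j := by
        have : (k : ℝ) < (j + 1 : ℕ) := by push_cast; linarith
        exact Nat.lt_succ_iff.1 (by exact_mod_cast this)
      exact ((hlt j).1 (hk1.trans_le (h1 k j hj' hjn))).le
    -- Without a second crossing, `(j - (k - 1)) (p j - q j)` would be nonnegative for all j and
    -- positive at n, yet it sums to zero as masses and means agree.
    have hright : ∃ b, n ≤ b ∧ p b / q b ≤ 1 := by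
      by_contra! hcon
      have hnn : ∀ j : ℕ, 0 ≤ ((j : ℝ) - (k - 1)) * (p j - q j) := by
        intro j
        rcases le_or_gt (j : ℝ) ((k : ℝ) - 1) with hj | hj
        · exact mul_nonneg_of_nonpos_of_nonpos (by linarith) (by linarith [hleft j hj])
        · refine mul_nonneg (by linarith) (sub_nonneg.2 ?_)
          rcases le_total j n with hjn | hjn
          · exact hmid j hj hjn
          · exact ((hlt j).1 (hcon j hjn)).le
      have hsum : HasSum (fun j : ℕ => ((j : ℝ) - (k - 1)) * (p j - q j)) 0 := by
        convert! (h.hasSum_mean.sub hqm).sub ((h.hasSum_one.sub hq1).mul_left ((k : ℝ) - 1)) using 1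
        · ext j; ring
        · ring
      have h5 := congrFun ((hasSum_zero_iff_of_nonneg hnn).1 hsum) n
      have h6 : (k : ℝ) ≤ n := by exact_mod_cast hkn
      have h7 := (hlt n).1 hn
      have h8 : 0 < ((n : ℝ) - (k - 1)) * (p n - q n) := mul_pos (by linarith) (by linarith)
      simp only [Pi.zero_apply] at h5
      linarith
    set b := Nat.find hright with hb
    obtain ⟨hbn, hb1⟩ : n ≤ b ∧ p b / q b ≤ 1 := Nat.find_spec hright
    -- The left point is `k - 1`, so that `j ≤ a` means `j < k`; it is -1 when `k = 0`.
    refine ⟨(k : ℝ) - 1, b, ?_, hleft, fun j hj hjb => ?_, fun j hj => ?_⟩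
    · have : (k : ℝ) ≤ b := by exact_mod_cast hkn.trans hbn
      linarith
    · rcases le_total j n with hjn | hjn
      · exact hmid j hj hjn
      · have := Nat.find_min hright (by exact_mod_cast hjb : j < b)
        rw [not_and, not_le] at this
        exact ((hlt j).1 (this hjn)).le
    · rw [← hle]
      exact (h2 b j hbn (by exact_mod_cast hj)).trans hb1

include hq hq1 hqm hrec in
/-- An ultra log-concave law is smaller than the Poisson law of the same mean in the convex
order. -/
lemma convex_order (h : IsUltraLogConcave p c m s) {f : ℝ → ℝ} (hf : ConvexOn ℝ Set.univ f)
    (hfq : Summable fun j : ℕ => f j * q j) :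
    (Summable fun j : ℕ => f j * p j) ∧ ∑' j : ℕ, f j * p j ≤ ∑' j : ℕ, f j * q j := by
  have hfp : Summable fun j : ℕ => f j * p j := by
    obtain ⟨C, hC0, hC⟩ := h.exists_le_mul hq hrec
    refine Summable.of_norm_bounded (hfq.abs.mul_left C) fun j => ?_
    rw [Real.norm_eq_abs, abs_mul, abs_mul, abs_of_pos (h.pos j), abs_of_pos (hq j),
      mul_left_comm]
    exact mul_le_mul_of_nonneg_left (hC j) (abs_nonneg _)
  refine ⟨hfp, ?_⟩
  rcases h.exists_crossing hq hq1 hqm hrec with heq | ⟨a, b, hab, hl, hm, hr⟩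
  · simp [heq]
  · set B := (f b - f a) / (b - a) with hB
    have key : ∀ j : ℕ, (f j - (f a + B * (j - a))) * (p j - q j) ≤ 0 := by
      intro j
      rcases le_or_gt (j : ℝ) a with hja | hja
      · exact mul_nonpos_of_nonneg_of_nonpos (hf.chord_le_left hja hab)
          (sub_nonpos.2 (hl j hja))
      rcases lt_or_ge (j : ℝ) b with hjb | hjb
      · exact mul_nonpos_of_nonpos_of_nonneg (hf.le_chord hja hjb)
          (sub_nonneg.2 (hm j hja hjb))
      · exact mul_nonpos_of_nonneg_of_nonpos (hf.chord_le_right hjb hab)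
          (sub_nonpos.2 (hr j hjb))
    -- The chord is affine, so it contributes nothing when masses and means agree.
    have hsum : HasSum (fun j : ℕ => (f j - (f a + B * (j - a))) * (p j - q j))
        (∑' j : ℕ, f j * p j - ∑' j : ℕ, f j * q j) := by
      convert! (hfp.hasSum.sub hfq.hasSum).sub
        (((h.hasSum_one.sub hq1).mul_left (f a - B * a)).add
          ((h.hasSum_mean.sub hqm).mul_left B)) using 1
      · ext j; ring
      · ring
    linarith [hsum.nonpos key]

end IsUltraLogConcave

end convexOrder

/-! ### Global Taylor bounds for `(1 + u) ^ ν` -/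

section expansion

variable {ν : ℝ}

lemma sq_le_mul_rpow_sub_one (hν : 1 ≤ ν) {u : ℝ} (hu : -1 ≤ u) :
    u ^ 2 ≤ u * ((1 + u) ^ ν - 1) := by
  rcases le_total 0 u with h | h
  · have := Real.self_le_rpow_of_one_le (by linarith : 1 ≤ 1 + u) hν
    nlinarith
  · have := Real.rpow_le_self_of_le_one (by linarith : 0 ≤ 1 + u) (by linarith) hν
    nlinarith

lemma exists_rpow_expansion (ν : ℝ) : ∃ c C ε : ℝ, 0 ≤ C ∧ 0 < ε ∧ ε ≤ 1 ∧
    ∀ u : ℝ, |u| < ε → |(1 + u) ^ ν - 1 - ν * u - c * u ^ 2| ≤ C * |u| ^ 3 := by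
  have h := (Real.one_add_rpow_hasFPowerSeriesAt_zero (a := ν)).isBigO_sub_partialSum_pow 3
  obtain ⟨C, hC, hb⟩ := h.exists_pos
  rw [isBigOWith_iff, Metric.eventually_nhds_iff] at hb
  obtain ⟨ε, hε, hb⟩ := hb
  refine ⟨Ring.choose ν 2, C, min ε 1, hC.le, lt_min hε one_pos, min_le_right _ _, fun u hu => ?_⟩
  have := hb (y := u) (by simpa using hu.trans_le (min_le_left _ _))
  simp only [zero_add, FormalMultilinearSeries.partialSum, Finset.sum_range_succ,
    Finset.range_zero, Finset.sum_empty, binomialSeries_apply] at this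
  simp at this
  convert this using 2
  ring

/-- Comparison of the Taylor remainders of `(1 + u) ^ ν` with nonnegative functions, valid on the
whole half line. -/
lemma exists_global_rpow_expansion (hν : 1 ≤ ν) : ∃ c C : ℝ, 0 ≤ C ∧ ∀ u : ℝ, -1 ≤ u →
    |(1 + u) ^ ν - 1 - ν * u| ≤ C * (u * ((1 + u) ^ ν - 1)) ∧
    |u * ((1 + u) ^ ν - 1 - ν * u - c * u ^ 2)| ≤ C * (u ^ 3 * ((1 + u) ^ ν - 1)) := by
  obtain ⟨c, C, ε, hC, hε, hε1, hb⟩ := exists_rpow_expansion ν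
  -- C covers the Taylor remainder for `|u| < ε`; the terms over `ε ^ 2` cover `|u| ≥ ε`, where each
  -- Taylor term is bounded separately.
  refine ⟨c, C + |c| / ε ^ 2 + (1 + ν) / ε ^ 2, by positivity, fun u hu => ?_⟩
  have h1 := sq_le_mul_rpow_sub_one hν hu
  set g := (1 + u) ^ ν - 1
  have hε2 : ε ^ 2 ≤ ε := by nlinarith
  have hε3 : 1 ≤ 1 / ε ^ 2 := by rw [le_div_iff₀ (by positivity)]; nlinarith
  have hc : |c| ≤ |c| / ε ^ 2 := by
    rw [div_eq_mul_one_div]; exact le_mul_of_one_le_right (abs_nonneg _) hε3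
  have hg0 : 0 ≤ u * g := (sq_nonneg u).trans h1
  have hug : u * g = |u| * |g| := by rw [← abs_mul, abs_of_nonneg hg0]
  have hu3 : u ^ 3 * g = u ^ 2 * (u * g) := by ring
  have hν2 : 0 ≤ (1 + ν) / ε ^ 2 := by positivity
  rcases lt_or_ge |u| ε with h | h
  · have h2 := hb u h
    have hcu : |c * u ^ 2| = |c| * u ^ 2 := by rw [abs_mul, abs_of_nonneg (sq_nonneg u)]
    constructor
    · have h3 : |g - ν * u| ≤ |g - ν * u - c * u ^ 2| + |c * u ^ 2| := by
        have := abs_add_le (g - ν * u - c * u ^ 2) (c * u ^ 2)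
        rwa [sub_add_cancel] at this
      have h4 : |u| ^ 3 ≤ u ^ 2 := by
        rw [← sq_abs u]
        exact pow_le_pow_of_le_one (abs_nonneg u) (by linarith) (by norm_num)
      rw [hcu] at h3
      calc |g - ν * u| ≤ C * |u| ^ 3 + |c| * u ^ 2 := by linarith
        _ ≤ C * u ^ 2 + |c| * u ^ 2 := by gcongr
        _ ≤ C * (u * g) + |c| / ε ^ 2 * (u * g) := by gcongr
        _ ≤ _ := by nlinarith
    · rw [abs_mul, hu3]
      calc |u| * |g - ν * u - c * u ^ 2| ≤ |u| * (C * |u| ^ 3) := by gcongr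
        _ = C * (u ^ 2 * u ^ 2) := by rw [← sq_abs u]; ring
        _ ≤ C * (u ^ 2 * (u * g)) := by gcongr
        _ ≤ _ := by
          gcongr
          have : 0 ≤ |c| / ε ^ 2 := by positivity
          linarith
  -- Away from zero `ε ≤ |u| ≤ |g|`, so missing powers of u are inserted at the cost of `1 / ε ^ 2`.
  · have hu0 : 0 < |u| := hε.trans_le h
    have hle : |u| ≤ |g| := by
      rw [hug, ← sq_abs, sq] at h1
      exact le_of_mul_le_mul_left h1 hu0
    have k1 : |g| ≤ 1 / ε ^ 2 * (u * g) := by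
      rw [hug, div_mul_eq_mul_div, one_mul, le_div_iff₀ (by positivity), mul_comm]
      gcongr
      linarith
    have k2 : |u| * |g| ≤ 1 / ε ^ 2 * (u ^ 3 * g) := by
      rw [hu3, hug, div_mul_eq_mul_div, one_mul, le_div_iff₀ (by positivity), mul_comm, ← sq_abs u]
      gcongr
    have k3 : |u| ^ 2 * |g| ≤ 1 / ε ^ 2 * (u ^ 3 * g) := by
      rw [hu3, hug, div_mul_eq_mul_div, one_mul, le_div_iff₀ (by positivity), mul_comm, ← sq_abs u,
        mul_left_comm]
      gcongr
      linarith
    constructor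
    · calc |g - ν * u| ≤ |g| + |ν * u| := abs_sub _ _
        _ = |g| + ν * |u| := by rw [abs_mul, abs_of_pos (by linarith : 0 < ν)]
        _ ≤ (1 + ν) * |g| := by nlinarith
        _ ≤ (1 + ν) * (1 / ε ^ 2 * (u * g)) := by gcongr
        _ = (1 + ν) / ε ^ 2 * (u * g) := by ring
        _ ≤ _ := by
          gcongr
          have : 0 ≤ |c| / ε ^ 2 := by positivity
          linarith
    · have h3 : |g - ν * u - c * u ^ 2| ≤ |g| + ν * |u| + |c| * |u| ^ 2 := by
        have e1 := abs_sub (g - ν * u) (c * u ^ 2)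
        have e2 := abs_sub g (ν * u)
        rw [abs_mul, abs_pow] at e1
        rw [abs_mul ν, abs_of_pos (by linarith : 0 < ν)] at e2
        linarith
      rw [abs_mul]
      calc |u| * |g - ν * u - c * u ^ 2| ≤ |u| * (|g| + ν * |u| + |c| * |u| ^ 2) := by gcongr
        _ ≤ |u| * (|g| + ν * |g| + |c| * (|u| * |g|)) := by
          rw [pow_two]
          gcongr
        _ = (1 + ν) * (|u| * |g|) + |c| * (|u| ^ 2 * |g|) := by ring
        _ ≤ (1 + ν) * (1 / ε ^ 2 * (u ^ 3 * g)) + |c| * (1 / ε ^ 2 * (u ^ 3 * g)) := by gcongr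
        _ = (|c| / ε ^ 2 + (1 + ν) / ε ^ 2) * (u ^ 3 * g) := by ring
        _ ≤ _ := by
          have : 0 ≤ u ^ 3 * g := by rw [hu3]; positivity
          gcongr
          linarith

end expansion

/-! ### Moments of the normalized deviation as the parameter grows -/

section moments

variable {r ν : ℝ}

/-- The value at `j` of the normalized deviation `(X - r ^ (1 / ν)) / r ^ (1 / ν)`. -/
noncomputable def cmpDev (r ν : ℝ) (j : ℕ) : ℝ := j / r ^ (1 / ν) - 1

/-- The moments of the normalized deviation. -/
noncomputable def cmpDevMoment (r ν : ℝ) (k : ℕ) : ℝ := ∑' j, cmpDev r ν j ^ k * cmpMass r ν j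

lemma cmpDev_succ (r ν : ℝ) (j : ℕ) : cmpDev r ν (j + 1) = cmpDev r ν j + 1 / r ^ (1 / ν) := by
  simp only [cmpDev]
  push_cast
  ring

lemma neg_one_le_cmpDev (hr : 0 < r) (j : ℕ) : -1 ≤ cmpDev r ν j := by
  have : 0 ≤ (j : ℝ) / r ^ (1 / ν) := by positivity
  simp only [cmpDev]
  linarith

lemma one_add_cmpDev_rpow (hr : 0 < r) (hν : 1 ≤ ν) (j : ℕ) :
    (1 + cmpDev r ν j) ^ ν = (j : ℝ) ^ ν / r := by
  have h1 : (r ^ (1 / ν)) ^ ν = r := by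
    rw [← Real.rpow_mul hr.le, one_div_mul_cancel (by linarith), Real.rpow_one]
  rw [cmpDev, add_sub_cancel, Real.div_rpow (by positivity) (by positivity), h1]

lemma summable_cmpDev_pow (hr : 0 < r) (hν : 1 ≤ ν) (k : ℕ) :
    Summable fun j => cmpDev r ν j ^ k * cmpMass r ν j := by
  refine summable_cmpMass_mul hr hν (C := 1) (a := Real.exp (1 / r ^ (1 / ν)) ^ k) (by positivity)
    fun j => ?_
  rw [one_mul, ← pow_mul, mul_comm k j, pow_mul, ← Real.exp_nat_mul, abs_pow]
  gcongr
  have h1 : 0 ≤ (j : ℝ) * (1 / r ^ (1 / ν)) := by positivity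
  have h2 := Real.add_one_le_exp ((j : ℝ) * (1 / r ^ (1 / ν)))
  rw [cmpDev, div_eq_mul_one_div, abs_le]
  constructor <;> linarith

lemma hasSum_cmpDev_pow (hr : 0 < r) (hν : 1 ≤ ν) (k : ℕ) :
    HasSum (fun j => cmpDev r ν j ^ k * cmpMass r ν j) (cmpDevMoment r ν k) :=
  (summable_cmpDev_pow hr hν k).hasSum

/-- The Stein identity of the Conway-Maxwell-Poisson distribution. -/
lemma hasSum_cmp_stein (hr : 0 < r) (hν : 1 ≤ ν) {g : ℕ → ℝ} {a b : ℝ}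
    (ha : HasSum (fun j => g j * cmpMass r ν j) a)
    (hb : HasSum (fun j => g (j + 1) * cmpMass r ν j) b) :
    HasSum (fun j => ((1 + cmpDev r ν j) ^ ν - 1) * g j * cmpMass r ν j) (b - a) := by
  -- Index shift by one; the term at 0 vanishes since `0 ^ ν = 0`.
  have h1 : HasSum (fun j : ℕ => (j : ℝ) ^ ν / r * g j * cmpMass r ν j) b := by
    rw [← hasSum_nat_add_iff' 1]
    simp only [Finset.range_one, Finset.sum_singleton, Nat.cast_zero,
      Real.zero_rpow (by linarith : ν ≠ 0), zero_div, zero_mul, sub_zero]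
    refine HasSum.congr_fun hb fun j => ?_
    have := rpow_mul_cmpMass_succ r ν j
    push_cast
    rw [div_mul_eq_mul_div, div_mul_eq_mul_div, div_eq_iff hr.ne']
    linear_combination g (j + 1) * this
  convert! h1.sub ha using 1
  ext j
  rw [one_add_cmpDev_rpow hr hν]
  ring

lemma hasSum_cmp_stein_zero (hr : 0 < r) (hν : 1 ≤ ν) :
    HasSum (fun j => ((1 + cmpDev r ν j) ^ ν - 1) * cmpMass r ν j) 0 := by
  have h := hasSum_cmpMass hr hν
  simpa using hasSum_cmp_stein hr hν (g := fun _ => 1) (a := 1) (b := 1) (by simpa using h) (by simpa using h)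

lemma hasSum_cmp_stein_one (hr : 0 < r) (hν : 1 ≤ ν) :
    HasSum (fun j => ((1 + cmpDev r ν j) ^ ν - 1) * cmpDev r ν j * cmpMass r ν j)
      (1 / r ^ (1 / ν)) := by
  have h0 := hasSum_cmpMass hr hν
  have h1 : HasSum (fun j => cmpDev r ν j * cmpMass r ν j) (cmpDevMoment r ν 1) := by
    simpa using hasSum_cmpDev_pow hr hν 1
  have h2 := h1.add (h0.mul_left (1 / r ^ (1 / ν)))
  convert! hasSum_cmp_stein hr hν h1 (HasSum.congr_fun h2 fun j => ?_) using 1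
  · ring
  · rw [cmpDev_succ]; ring

lemma hasSum_cmp_stein_two (hr : 0 < r) (hν : 1 ≤ ν) :
    HasSum (fun j => ((1 + cmpDev r ν j) ^ ν - 1) * cmpDev r ν j ^ 2 * cmpMass r ν j)
      (2 * (1 / r ^ (1 / ν)) * cmpDevMoment r ν 1 + (1 / r ^ (1 / ν)) ^ 2) := by
  have h0 := hasSum_cmpMass hr hν
  have h1 := hasSum_cmpDev_pow hr hν 1
  have h2 := hasSum_cmpDev_pow hr hν 2
  have h3 := (h2.add (h1.mul_left (2 * (1 / r ^ (1 / ν))))).add (h0.mul_left ((1 / r ^ (1 / ν)) ^ 2))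
  convert! hasSum_cmp_stein hr hν h2 (HasSum.congr_fun h3 fun j => ?_) using 1
  · ring
  · rw [cmpDev_succ]; ring

lemma hasSum_cmp_stein_three (hr : 0 < r) (hν : 1 ≤ ν) :
    HasSum (fun j => ((1 + cmpDev r ν j) ^ ν - 1) * cmpDev r ν j ^ 3 * cmpMass r ν j)
      (3 * (1 / r ^ (1 / ν)) * cmpDevMoment r ν 2 + 3 * (1 / r ^ (1 / ν)) ^ 2 * cmpDevMoment r ν 1 +
        (1 / r ^ (1 / ν)) ^ 3) := by
  have h0 := hasSum_cmpMass hr hν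
  have h1 := hasSum_cmpDev_pow hr hν 1
  have h2 := hasSum_cmpDev_pow hr hν 2
  have h3 := hasSum_cmpDev_pow hr hν 3
  have h4 := ((h3.add (h2.mul_left (3 * (1 / r ^ (1 / ν))))).add
    (h1.mul_left (3 * (1 / r ^ (1 / ν)) ^ 2))).add (h0.mul_left ((1 / r ^ (1 / ν)) ^ 3))
  convert! hasSum_cmp_stein hr hν h3 (HasSum.congr_fun h4 fun j => ?_) using 1
  · ring
  · rw [cmpDev_succ]; ring

lemma HasSum.abs_le_of_abs_le {a b : ℕ → ℝ} {A B : ℝ} (ha : HasSum a A) (hb : HasSum b B)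
    (h : ∀ j, |a j| ≤ b j) : |A| ≤ B :=
  abs_le.2 ⟨by linarith [hasSum_le (fun j => (abs_le.1 (h j)).1) hb.neg ha],
    hasSum_le (fun j => (abs_le.1 (h j)).2) ha hb⟩

/-- Asymptotics of the first two moments of the normalized deviation. -/
lemma exists_cmpDevMoment_bound (hν : 1 ≤ ν) : ∃ K : ℝ, 0 ≤ K ∧ ∀ r : ℝ, 1 ≤ r →
    |cmpDevMoment r ν 1| ≤ K * (1 / r ^ (1 / ν)) ∧
    |1 / r ^ (1 / ν) - ν * cmpDevMoment r ν 2| ≤ K * (1 / r ^ (1 / ν)) ^ 2 := by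
  obtain ⟨c, C, hC, hb⟩ := exists_global_rpow_expansion hν
  -- The first C bounds the first moment (`j1`); the rest comes from inserting the third moment
  -- bound `j3` into `j4`.
  refine ⟨C + (|c| * (2 * C + 1 + C * (4 + 3 * C)) + C * (4 + 3 * C)), by positivity, fun r hr1 => ?_⟩
  have hr : 0 < r := by linarith
  have hu := neg_one_le_cmpDev (ν := ν) hr
  have hp := cmpMass_pos hr hν
  have N0 := hasSum_cmp_stein_zero hr hν
  have N1 := hasSum_cmp_stein_one hr hν
  have N2 := hasSum_cmp_stein_two hr hν
  have N3 := hasSum_cmp_stein_three hr hν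
  have M1 := hasSum_cmpDev_pow hr hν 1
  have M2 := hasSum_cmpDev_pow hr hν 2
  have M3 := hasSum_cmpDev_pow hr hν 3
  have hδ1 : 1 / r ^ (1 / ν) ≤ 1 := by
    rw [div_le_one (by positivity)]
    exact Real.one_le_rpow hr1 (by positivity)
  have hδ0 : 0 < 1 / r ^ (1 / ν) := by positivity
  set δ := 1 / r ^ (1 / ν)
  set m1 := cmpDevMoment r ν 1
  set m2 := cmpDevMoment r ν 2
  set m3 := cmpDevMoment r ν 3
  have i2 : m2 ≤ δ := hasSum_le (fun j => by
    refine mul_le_mul_of_nonneg_right ?_ (hp j).le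
    rw [mul_comm]; exact sq_le_mul_rpow_sub_one hν (hu j)) M2 N1
  have i1 : |0 - ν * m1| ≤ C * δ := by
    refine HasSum.abs_le_of_abs_le (N0.sub (M1.mul_left ν)) (N1.mul_left C) fun j => ?_
    have := mul_le_mul_of_nonneg_right (hb _ (hu j)).1 (hp j).le
    rw [← abs_of_pos (hp j), ← abs_mul, abs_of_pos (hp j)] at this
    refine le_of_eq_of_le (congrArg abs ?_) (this.trans_eq ?_) <;> ring
  have i3 : |2 * δ * m1 + δ ^ 2 - ν * m3| ≤ C * (3 * δ * m2 + 3 * δ ^ 2 * m1 + δ ^ 3) := by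
    refine HasSum.abs_le_of_abs_le (N2.sub (M3.mul_left ν)) (N3.mul_left C) fun j => ?_
    have := mul_le_mul_of_nonneg_right (hb _ (hu j)).1
      (mul_nonneg (sq_nonneg (cmpDev r ν j)) (hp j).le)
    rw [← abs_of_nonneg (mul_nonneg (sq_nonneg (cmpDev r ν j)) (hp j).le), ← abs_mul,
      abs_of_nonneg (mul_nonneg (sq_nonneg (cmpDev r ν j)) (hp j).le)] at this
    refine le_of_eq_of_le (congrArg abs ?_) (this.trans_eq ?_) <;> ring
  have i4 : |δ - ν * m2 - c * m3| ≤ C * (3 * δ * m2 + 3 * δ ^ 2 * m1 + δ ^ 3) := by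
    refine HasSum.abs_le_of_abs_le ((N1.sub (M2.mul_left ν)).sub (M3.mul_left c)) (N3.mul_left C)
      fun j => ?_
    have := mul_le_mul_of_nonneg_right (hb _ (hu j)).2 (hp j).le
    rw [← abs_of_pos (hp j), ← abs_mul, abs_of_pos (hp j)] at this
    refine le_of_eq_of_le (congrArg abs ?_) (this.trans_eq ?_) <;> ring
  have j1 : |m1| ≤ C * δ := by
    rw [zero_sub, abs_neg, abs_mul, abs_of_pos (by linarith : 0 < ν)] at i1
    nlinarith [abs_nonneg m1]
  have hδ3 : δ ^ 3 ≤ δ ^ 2 := pow_le_pow_of_le_one hδ0.le hδ1 (by norm_num)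
  have jN : 3 * δ * m2 + 3 * δ ^ 2 * m1 + δ ^ 3 ≤ (4 + 3 * C) * δ ^ 2 := by
    have e1 : δ * m2 ≤ δ * δ := by gcongr
    have e2 : δ ^ 2 * m1 ≤ δ ^ 2 * (C * δ) := by gcongr; exact (le_abs_self _).trans j1
    have e3 : C * δ ^ 3 ≤ C * δ ^ 2 := by gcongr
    nlinarith
  have jN' := mul_le_mul_of_nonneg_left jN hC
  have j3 : |m3| ≤ (2 * C + 1 + C * (4 + 3 * C)) * δ ^ 2 := by
    have e1 : |ν * m3| ≤ |2 * δ * m1 + δ ^ 2| + |2 * δ * m1 + δ ^ 2 - ν * m3| := by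
      have := abs_sub (2 * δ * m1 + δ ^ 2) (2 * δ * m1 + δ ^ 2 - ν * m3)
      rwa [sub_sub_cancel] at this
    have e2 : |2 * δ * m1 + δ ^ 2| ≤ 2 * δ * |m1| + δ ^ 2 := by
      have := abs_add_le (2 * δ * m1) (δ ^ 2)
      rwa [abs_mul, abs_of_pos (by positivity : 0 < 2 * δ), abs_of_pos (pow_pos hδ0 2)] at this
    have e3 : δ * |m1| ≤ δ * (C * δ) := by gcongr
    rw [abs_mul, abs_of_pos (by linarith : 0 < ν)] at e1
    nlinarith [abs_nonneg m3]
  have j4 : |δ - ν * m2| ≤ |c| * |m3| + C * ((4 + 3 * C) * δ ^ 2) := by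
    have e1 := abs_add_le (δ - ν * m2 - c * m3) (c * m3)
    rw [sub_add_cancel, abs_mul] at e1
    linarith
  constructor
  · refine j1.trans (mul_le_mul_of_nonneg_right ?_ hδ0.le)
    exact le_add_of_nonneg_right (by positivity)
  · have e1 := mul_le_mul_of_nonneg_left j3 (abs_nonneg c)
    have e2 : 0 ≤ C * δ ^ 2 := by positivity
    linarith

/-- The bound on the total variation distance is `(ν - 1) / ν + O(r ^ (-1 / ν))`. -/
lemma isBigO_cmp_bound (hν : 1 ≤ ν) {mean sq : ℝ → ℝ}
    (hm : ∀ r, 0 < r → HasSum (fun j : ℕ => (j : ℝ) * cmpMass r ν j) (mean r))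
    (hs : ∀ r, 0 < r → HasSum (fun j : ℕ => (j : ℝ) ^ 2 * cmpMass r ν j) (sq r)) :
    (fun r : ℝ => 1 / mean r * (mean r - (sq r - mean r ^ 2)) - (ν - 1) / ν) =O[atTop]
      fun r : ℝ => r ^ (-1 / ν) := by
  obtain ⟨K, hK, hb⟩ := exists_cmpDevMoment_bound hν
  have hlim : Tendsto (fun r : ℝ => K * (1 / r ^ (1 / ν))) atTop (nhds 0) := by
    have := (tendsto_rpow_atTop (by positivity : 0 < 1 / ν)).inv_tendsto_atTop.const_mul K
    simpa using this
  -- The numerator of `hform` is at most `(2 K + ν K²) δ²`. Once `K δ ≤ 1 / 2`, its denominator is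
  -- at least `δ / 2`, whence the factor 2.
  refine IsBigO.of_bound (2 * (2 * K + ν * K ^ 2)) ?_
  filter_upwards [eventually_ge_atTop 1, hlim.eventually_le_const (by norm_num : (0 : ℝ) < 1 / 2)]
    with r hr1 hr2
  have hr : 0 < r := by linarith
  obtain ⟨h1, h2⟩ := hb r hr1
  have hα : 0 < r ^ (1 / ν) := by positivity
  have e0 := hasSum_cmpMass hr hν
  have e1 := hasSum_cmpDev_pow hr hν 1
  have e2 := hasSum_cmpDev_pow hr hν 2
  have hrδ : r ^ (-1 / ν) = 1 / r ^ (1 / ν) := by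
    rw [neg_div, Real.rpow_neg hr.le, one_div (r ^ _)]
  rw [hrδ]
  set α := r ^ (1 / ν) with hαd
  set m1 := cmpDevMoment r ν 1
  set m2 := cmpDevMoment r ν 2
  have hmean : mean r = α * (1 + m1) := by
    refine (hm r hr).unique (HasSum.congr_fun ((e0.add e1).mul_left α) fun j => ?_)
    rw [cmpDev, ← hαd]
    field_simp
    ring
  have hsq : sq r = α ^ 2 * (1 + 2 * m1 + m2) := by
    refine (hs r hr).unique
      (HasSum.congr_fun (((e0.add (e1.mul_left 2)).add e2).mul_left (α ^ 2)) fun j => ?_)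
    rw [cmpDev, ← hαd]
    field_simp
    ring
  have hm1 : 1 / 2 ≤ 1 + m1 := by linarith [(abs_le.1 (h1.trans hr2)).1]
  have hm10 : 1 + m1 ≠ 0 := by linarith
  have hν0 : ν ≠ 0 := by linarith
  have hνp : 0 < ν := by linarith
  have hαδ : α = 1 / (1 / α) := by field_simp
  have hδ0 : 0 < 1 / α := by positivity
  rw [hmean, hsq]
  generalize 1 / α = δ at *
  rw [hαδ]
  have hδn := hδ0.ne'
  have hform : 1 / (1 / δ * (1 + m1)) * (1 / δ * (1 + m1) -
      ((1 / δ) ^ 2 * (1 + 2 * m1 + m2) - (1 / δ * (1 + m1)) ^ 2)) - (ν - 1) / ν =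
      ((δ - ν * m2) + δ * m1 + ν * m1 ^ 2) / (ν * δ * (1 + m1)) := by
    field_simp
    ring
  rw [hform, Real.norm_eq_abs, Real.norm_of_nonneg hδ0.le, abs_div,
    abs_of_pos (by positivity : 0 < ν * δ * (1 + m1)), div_le_iff₀ (by positivity)]
  have hnum : |(δ - ν * m2) + δ * m1 + ν * m1 ^ 2| ≤ (2 * K + ν * K ^ 2) * δ ^ 2 := by
    have k1 := abs_add_le (δ - ν * m2 + δ * m1) (ν * m1 ^ 2)
    have k2 := abs_add_le (δ - ν * m2) (δ * m1)
    rw [abs_mul, abs_of_pos hδ0] at k2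
    rw [abs_mul, abs_of_pos hνp, abs_pow] at k1
    have k3 : δ * |m1| ≤ δ * (K * δ) := by gcongr
    have k4 : ν * |m1| ^ 2 ≤ ν * (K * δ) ^ 2 := by gcongr
    nlinarith
  refine hnum.trans ?_
  have : 1 ≤ 2 * (ν * (1 + m1)) := by nlinarith
  have hc : 0 ≤ (2 * K + ν * K ^ 2) * δ ^ 2 := by positivity
  calc (2 * K + ν * K ^ 2) * δ ^ 2 ≤ (2 * K + ν * K ^ 2) * δ ^ 2 * (2 * (ν * (1 + m1))) :=
        le_mul_of_one_le_right hc this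
    _ = _ := by ring

end moments

/-! ### Transfer to measures and conclusion -/

section main

variable {l ν μ : ℝ}

/-- The second moment of a Conway-Maxwell-Poisson law. -/
lemma hasSum_sq_cmpMass (hl : 0 < l) (hν : 1 ≤ ν) :
    HasSum (fun j : ℕ => (j : ℝ) ^ 2 * cmpMass l ν j) (∫ n, (n : ℝ) ^ 2 ∂cmpMeasure l ν) := by
  rw [integral_cmpMeasure hl hν]
  exact (summable_pow_mul_cmpMass hl hν 2).hasSum

lemma hasSum_mean_cmpMass (hl : 0 < l) (hν : 1 ≤ ν) :
    HasSum (fun j : ℕ => (j : ℝ) * cmpMass l ν j) (∫ n, (n : ℝ) ∂cmpMeasure l ν) := by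
  rw [integral_cmpMeasure hl hν]
  simpa using (summable_pow_mul_cmpMass hl hν 1).hasSum

lemma cmp_isUltraLogConcave (hl : 0 < l) (hν : 1 ≤ ν) :
    IsUltraLogConcave (cmpMass l ν) (fun j => l * ((j : ℝ) + 1) ^ (1 - ν))
      (∫ n, (n : ℝ) ∂cmpMeasure l ν) (∫ n, (n : ℝ) ^ 2 ∂cmpMeasure l ν) := by
  rw [integral_cmpMeasure hl hν, integral_cmpMeasure hl hν]
  exact isUltraLogConcave_cmpMass hl hν

lemma isProbabilityMeasure_cmp (hl : 0 < l) (hν : 1 ≤ ν) : IsProbabilityMeasure (cmpMeasure l ν) :=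
  (hasSum_cmpMass hl hν).isProbabilityMeasure_sum_dirac fun j => (cmpMass_pos hl hν j).le

lemma memLp_cmpMeasure_iff (hl : 0 < l) (hν : 1 ≤ ν) {f : ℕ → ℝ} :
    MemLp f 2 (cmpMeasure l ν) ↔ Summable fun j => f j ^ 2 * cmpMass l ν j := by
  rw [memLp_two_iff_integrable_sq .of_discrete, integrable_cmpMeasure_iff hl hν]

lemma memLp_natCast_cmpMeasure (hl : 0 < l) (hν : 1 ≤ ν) :
    MemLp (fun n : ℕ => (n : ℝ)) 2 (cmpMeasure l ν) :=
  (memLp_cmpMeasure_iff hl hν).2 (summable_pow_mul_cmpMass hl hν 2)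

lemma variance_cmpMeasure (hl : 0 < l) (hν : 1 ≤ ν) :
    Var[fun n : ℕ => (n : ℝ); cmpMeasure l ν] =
      ∫ n, (n : ℝ) ^ 2 ∂cmpMeasure l ν - (∫ n, (n : ℝ) ∂cmpMeasure l ν) ^ 2 := by
  have := isProbabilityMeasure_cmp hl hν
  exact variance_eq_sub (memLp_natCast_cmpMeasure hl hν)

lemma poisson_rec (μ : ℝ) (j : ℕ) :
    ((j : ℝ) + 1) * cmpMass μ 1 (j + 1) = μ * cmpMass μ 1 j := by
  simpa using rpow_mul_cmpMass_succ μ 1 j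

lemma natTVDist_cmpMeasure_le (hl : 0 < l) (hν : 1 ≤ ν)
    (hμ : μ = ∫ n, (n : ℝ) ∂cmpMeasure l ν) :
    natTVDist (cmpMeasure l ν) (cmpMeasure μ 1) ≤
      1 / μ * (μ - Var[fun n : ℕ => (n : ℝ); cmpMeasure l ν]) := by
  have h := cmp_isUltraLogConcave hl hν
  rw [variance_cmpMeasure hl hν, ← hμ]
  rw [← hμ] at h
  have hμ0 := h.mean_pos
  refine ciSup_le fun A => ?_
  rw [cmpMeasure_real hl hν, cmpMeasure_real hμ0 le_rfl]
  exact h.abs_tsum_sub_le (cmpMass_pos hμ0 le_rfl) (hasSum_cmpMass hμ0 le_rfl) (poisson_rec μ)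
    (Set.indicator_nonneg fun _ _ => zero_le_one)
    (Set.indicator_le' (fun _ _ => le_rfl) fun _ _ => zero_le_one)

lemma cmp_convex_order (hl : 0 < l) (hν : 1 ≤ ν) (hμ : μ = ∫ n, (n : ℝ) ∂cmpMeasure l ν)
    {f : ℝ → ℝ} (hf : ConvexOn ℝ Set.univ f) (hfq : Summable fun j : ℕ => f j * cmpMass μ 1 j) :
    (Summable fun j : ℕ => f j * cmpMass l ν j) ∧
      ∑' j : ℕ, f j * cmpMass l ν j ≤ ∑' j : ℕ, f j * cmpMass μ 1 j := by
  have h := cmp_isUltraLogConcave hl hν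
  rw [← hμ] at h
  have hμ0 := h.mean_pos
  have hm := (isUltraLogConcave_cmpMass hμ0 le_rfl).hasSum_mean
  rw [tsum_mul_poisson hμ0] at hm
  exact h.convex_order (cmpMass_pos hμ0 le_rfl) (hasSum_cmpMass hμ0 le_rfl) hm (poisson_rec μ) hf hfq

lemma convexOrderLE_cmpMeasure (hl : 0 < l) (hν : 1 ≤ ν)
    (hμ : μ = ∫ n, (n : ℝ) ∂cmpMeasure l ν) :
    ConvexOrderLE ((cmpMeasure l ν).map fun n : ℕ => (n : ℝ))
      ((cmpMeasure μ 1).map fun n : ℕ => (n : ℝ)) := by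
  have hμ0 : 0 < μ := hμ ▸ (cmp_isUltraLogConcave hl hν).mean_pos
  have hi : ∀ {l ν : ℝ}, 0 < l → 1 ≤ ν → ∀ {f : ℝ → ℝ}, Continuous f →
      (Integrable f ((cmpMeasure l ν).map fun n : ℕ => (n : ℝ)) ↔
        Summable fun j : ℕ => f j * cmpMass l ν j) := by
    intro l ν hl hν f hf
    rw [integrable_map_measure hf.aestronglyMeasurable .of_discrete, ← integrable_cmpMeasure_iff hl hν]
    rfl
  have he : ∀ {l ν : ℝ}, 0 < l → 1 ≤ ν → ∀ {f : ℝ → ℝ}, Continuous f →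
      ∫ x, f x ∂((cmpMeasure l ν).map fun n : ℕ => (n : ℝ)) = ∑' j : ℕ, f j * cmpMass l ν j := by
    intro l ν hl hν f hf
    rw [integral_map .of_discrete hf.aestronglyMeasurable, integral_cmpMeasure hl hν]
  refine ⟨(hi hl hν continuous_id).2 (hasSum_mean_cmpMass hl hν).summable,
    (hi hμ0 le_rfl continuous_id).2 (hasSum_mean_cmpMass hμ0 le_rfl).summable, ?_,
    fun f hf hfq => ?_⟩
  · rw [he hl hν continuous_id', he hμ0 le_rfl continuous_id']
    rw [tsum_mul_poisson hμ0, hμ, (hasSum_mean_cmpMass hl hν).tsum_eq]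
  -- A finite convex function on the line is continuous, which supplies the measurability needed
  -- under the push-forward.
  · have hc : Continuous f := continuousOn_univ.1 (hf.continuousOn isOpen_univ)
    have := cmp_convex_order hl hν hμ hf ((hi hμ0 le_rfl hc).1 hfq)
    rw [hi hl hν hc, he hl hν hc, he hμ0 le_rfl hc]
    exact this

/-- Markov's inequality for `z ^ X`, whose mean is at most the Poisson generating function by convex
order. Taking `z ≥ 1` serves the upper tail and `z ≤ 1` the lower. -/
lemma cmpMeasure_real_le (hl : 0 < l) (hν : 1 ≤ ν) (hμ : μ = ∫ n, (n : ℝ) ∂cmpMeasure l ν)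
    {z a : ℝ} (hz : 0 < z) {A : Set ℕ} (hA : ∀ n ∈ A, z ^ a ≤ z ^ (n : ℝ)) :
    (cmpMeasure l ν).real A ≤ Real.exp (μ * (z - 1)) * z ^ (-a) := by
  have hq := hasSum_pow_mul_poisson μ z
  simp only [← Real.rpow_natCast] at hq
  obtain ⟨h1, h2⟩ := cmp_convex_order hl hν hμ (convexOn_rpow_left hz) hq.summable
  rw [hq.tsum_eq] at h2
  rw [cmpMeasure_real hl hν]
  have hza := Real.rpow_pos_of_pos hz (-a)
  calc ∑' j, A.indicator (fun _ => 1) j * cmpMass l ν j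
      ≤ ∑' j : ℕ, z ^ (-a) * (z ^ (j : ℝ) * cmpMass l ν j) := by
        refine Summable.tsum_le_tsum (fun j => ?_) ?_ (h1.mul_left _)
        · rw [← mul_assoc]
          refine mul_le_mul_of_nonneg_right ?_ (cmpMass_pos hl hν j).le
          by_cases hj : j ∈ A
          · rw [Set.indicator_of_mem hj]
            calc (1 : ℝ) = z ^ (-a) * z ^ a := by rw [← Real.rpow_add hz]; simp
              _ ≤ _ := mul_le_mul_of_nonneg_left (hA j hj) hza.le
          · rw [Set.indicator_of_notMem hj]
            positivity
        · exact summable_mul_mass (cmpMass_pos hl hν) (hasSum_cmpMass hl hν)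
            (Set.indicator_nonneg fun _ _ => zero_le_one)
            (Set.indicator_le' (fun _ _ => le_rfl) fun _ _ => zero_le_one)
    _ = z ^ (-a) * ∑' j : ℕ, z ^ (j : ℝ) * cmpMass l ν j := tsum_mul_left
    _ ≤ z ^ (-a) * Real.exp (μ * (z - 1)) := by gcongr
    _ = _ := mul_comm _ _

variable {Ω : Type*} [MeasurableSpace Ω] {P : Measure Ω} {X : Ω → ℕ}

lemma poincareConstant_le (hl : 0 < l) (hν : 1 ≤ ν) (hX : HasLaw X (cmpMeasure l ν) P)
    (hμ : μ = ∫ n, (n : ℝ) ∂cmpMeasure l ν) : poincareConstant X P ≤ ENNReal.ofReal μ := by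
  have h := cmp_isUltraLogConcave hl hν
  rw [← hμ] at h
  refine iSup₂_le fun g ⟨hg2, hg0⟩ => ENNReal.div_le_of_le_mul ?_
  have e : ∀ f : ℕ → ℝ≥0∞, ∫⁻ ω, f (X ω) ∂P = ∑' j, ENNReal.ofReal (cmpMass l ν j) * f j :=
    fun f => by rw [← lintegral_cmpMeasure, ← hX.map_eq, lintegral_map' .of_discrete hX.aemeasurable]
  have hg2' : Summable fun j => g j ^ 2 * cmpMass l ν j := by
    rw [← memLp_cmpMeasure_iff hl hν, ← hX.map_eq,
      memLp_map_measure_iff .of_discrete hX.aemeasurable]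
    exact hg2
  have := isProbabilityMeasure_cmp hl hν
  have hgi : Integrable g (cmpMeasure l ν) :=
    ((memLp_cmpMeasure_iff hl hν).2 hg2').integrable one_le_two
  have hg0' : HasSum (fun j => g j * cmpMass l ν j) 0 := by
    rw [← hg0, ← integral_map hX.aemeasurable .of_discrete, hX.map_eq, integral_cmpMeasure hl hν]
    exact ((integrable_cmpMeasure_iff hl hν).1 hgi).hasSum
  rw [e fun n => ENNReal.ofReal (g n ^ 2), e fun n => ENNReal.ofReal ((g (n + 1) - g n) ^ 2)]
  exact h.tsum_sq_le hg2' hg0'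

/-- The variance is a lower bound of the Poincaré constant, by the test function `n ↦ n - E X`. -/
lemma ofReal_variance_le_poincareConstant [IsProbabilityMeasure P]
    (hX : MemLp (fun ω => (X ω : ℝ)) 2 P) :
    ENNReal.ofReal Var[fun ω => (X ω : ℝ); P] ≤ poincareConstant X P := by
  set M := ∫ ω, (X ω : ℝ) ∂P with hM
  have hmem : MemLp (fun ω => (X ω : ℝ) - M) 2 P := hX.sub (memLp_const M)
  refine le_iSup₂_of_le (fun n : ℕ => (n : ℝ) - M) ⟨hmem, ?_⟩ ?_
  · rw [integral_sub (hX.integrable one_le_two) (integrable_const M)]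
    simp [hM]
  · rw [variance_eq_integral hX.aestronglyMeasurable.aemeasurable,
      ofReal_integral_eq_lintegral_ofReal hmem.integrable_sq (ae_of_all _ fun _ => sq_nonneg _)]
    simp [hM]

end main

theorem mainTheorem10 {Ω : Type*} [MeasurableSpace Ω] (P : Measure Ω) (X : Ω → ℕ) (l ν μ : ℝ)
    (hl : 0 < l) (hν : 1 ≤ ν) (hX : HasLaw X (cmpMeasure l ν) P)
    (hμ : μ = ∫ ω, (X ω : ℝ) ∂P) :
    -- finite second moment and positive mean
    (MemLp (fun ω => (X ω : ℝ)) 2 P ∧ 0 < μ) ∧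
    -- (i)
    (natTVDist (P.map X) (poissonMeasure μ.toNNReal) ≤
        1 / μ * (μ - Var[fun ω => (X ω : ℝ); P]) ∧
      (fun r : ℝ =>
          1 / (∫ n, (n : ℝ) ∂(cmpMeasure r ν)) *
            ((∫ n, (n : ℝ) ∂(cmpMeasure r ν)) - Var[fun n : ℕ => (n : ℝ); cmpMeasure r ν])
          - (ν - 1) / ν) =O[atTop] fun r : ℝ => r ^ (-1 / ν)) ∧
    -- (ii)
    (ENNReal.ofReal Var[fun ω => (X ω : ℝ); P] ≤ poincareConstant X P ∧
      poincareConstant X P ≤ ENNReal.ofReal μ) ∧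
    -- (iii)
    (ConvexOrderLE (P.map fun ω => (X ω : ℝ))
        ((poissonMeasure μ.toNNReal).map fun n : ℕ => (n : ℝ)) ∧
      (∀ t : ℝ, 0 ≤ t →
        P.real {ω | μ + t ≤ (X ω : ℝ)} ≤ Real.exp t * (1 + t / μ) ^ (-(μ + t))) ∧
      (∀ t : ℝ, 0 ≤ t → t < μ →
        P.real {ω | (X ω : ℝ) ≤ μ - t} ≤ Real.exp (-t) * (1 - t / μ) ^ (t - μ))) := by
  have hprob := isProbabilityMeasure_cmp hl hν
  have hP : IsProbabilityMeasure P := hX.isProbabilityMeasure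
  have hμ' : μ = ∫ n, (n : ℝ) ∂cmpMeasure l ν := by
    rw [hμ, ← hX.map_eq, integral_map hX.aemeasurable .of_discrete]
  have hμ0 : 0 < μ := hμ' ▸ (cmp_isUltraLogConcave hl hν).mean_pos
  have hmem : MemLp (fun ω => (X ω : ℝ)) 2 P := by
    have := memLp_natCast_cmpMeasure hl hν
    rw [← hX.map_eq, memLp_map_measure_iff .of_discrete hX.aemeasurable] at this
    exact this
  have hvar : Var[fun ω => (X ω : ℝ); P] = Var[fun n : ℕ => (n : ℝ); cmpMeasure l ν] := by
    rw [← hX.map_eq, variance_map .of_discrete hX.aemeasurable]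
    rfl
  have hmap : P.map (fun ω => (X ω : ℝ)) = (cmpMeasure l ν).map fun n : ℕ => (n : ℝ) := by
    rw [← hX.map_eq, AEMeasurable.map_map_of_aemeasurable .of_discrete hX.aemeasurable]
    rfl
  refine ⟨⟨hmem, hμ0⟩, ⟨?_, ?_⟩, ⟨ofReal_variance_le_poincareConstant hmem,
    poincareConstant_le hl hν hX hμ'⟩, ?_, fun t ht => ?_, fun t ht htμ => ?_⟩
  · rw [hvar, hX.map_eq, poissonMeasure_eq_cmpMeasure hμ0]
    exact natTVDist_cmpMeasure_le hl hν hμ'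
  · refine (isBigO_cmp_bound hν (fun r hr => hasSum_mean_cmpMass hr hν)
      fun r hr => hasSum_sq_cmpMass hr hν).congr' ?_ EventuallyEq.rfl
    filter_upwards [eventually_gt_atTop 0] with r hr
    rw [variance_cmpMeasure hr hν]
  · rw [hmap, poissonMeasure_eq_cmpMeasure hμ0]
    exact convexOrderLE_cmpMeasure hl hν hμ'
  · rw [hX.measureReal_eq (p := fun n : ℕ => μ + t ≤ n) .of_discrete]
    have ht0 : 0 ≤ t / μ := by positivity
    -- `z = a / μ` minimizes `exp (μ (z - 1)) * z ^ (-a)`; the lower tail makes the same choice.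
    have h := cmpMeasure_real_le hl hν hμ' (z := 1 + t / μ) (a := μ + t) (by positivity)
      (A := {n : ℕ | μ + t ≤ n})
      fun n hn => Real.rpow_le_rpow_of_exponent_le (by linarith) hn
    rwa [add_sub_cancel_left, mul_div_cancel₀ _ hμ0.ne'] at h
  · rw [hX.measureReal_eq (p := fun n : ℕ => (n : ℝ) ≤ μ - t) .of_discrete]
    have ht0 : 0 ≤ t / μ := by positivity
    have ht1 : 0 < 1 - t / μ := by rw [sub_pos, div_lt_one hμ0]; exact htμ
    have h := cmpMeasure_real_le hl hν hμ' (z := 1 - t / μ) (a := μ - t) ht1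
      (A := {n : ℕ | (n : ℝ) ≤ μ - t})
      fun n hn => Real.rpow_le_rpow_of_exponent_ge ht1 (by linarith) hn
    rwa [sub_sub_cancel_left, mul_neg, mul_div_cancel₀ _ hμ0.ne', neg_sub] at h
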